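/- **Conventions.** All groups are profinite, all subgroups are closed and all homomorphisms are continuous; finite groups are discrete. A profinite group $G$ is *just infinite* if it is infinite and each of its nontrivial normal subgroups has finite index; it is *hereditarily just infinite* if in addition every open subgroup of $G$ is just infinite. $G$ is *prosoluble* if it is an inverse limit of finite soluble groups, and *virtually prosoluble* if some open subgroup is prosoluble. $\mathrm{M}(G)$ denotes the intersection of all maximal open normal subgroups of $G$. A *chief factor* of $G$ is a quotient $R/S$, where $S<R$ are normal subgroups of $G$ and no normal subgroup of $G$ lies strictly between them. A group $G$ acting on a set $X$ with kernel $K$ acts *subprimitively* if, for every normal subgroup $H$ of $G$, the group $H/(H\cap K)$ acts faithfully on every $H$-orbit. **Theorem.** Let $\Lambda=\{(G_n)_{n>0},\ \rho_n:G_{n+1}\twoheadrightarrow G_n\}$ be an inverse system of finite groups with surjective maps. Let $A_n$ be a normal subgroup of $G_n$ and set $P_n=\rho_n(A_{n+1})$ for $n>0$. Suppose that the following conditions hold for all sufficiently large $n$: 1. $\mathrm{M}(A_{n+1})=\ker\rho_n\ge P_{n+1}$; 2. $A_n>\mathrm{C}_{G_n}(P_n)$ (strict inclusion); 3. $P_n$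 is a direct product of nonabelian simple groups, $G_n$ permutes the simple factors of $P_n$ subprimitively by conjugation, and $\mathrm{N}_{G_n}(F)/F\,\mathrm{C}_{G_n}(F)$ is soluble for each simple factor $F$ of $P_n$. Then $G=\varprojlim G_n$ is hereditarily just infinite and not virtually prosoluble. Conversely, every profinite group $G$ satisfying the following condition is isomorphic, as a topological group, to the inverse limit of such an inverse system $\Lambda$ (for a suitable choice of normal subgroups $A_n$ satisfying 1–3 for all sufficiently large $n$): $(**)$ $G$ is just infinite, and there are infinitely many nonabelian chief factors $R/S$ of $G$ such that the simple factors of $R/S$ are permuted subprimitively by conjugation in $G/S$ and such that $\mathrm{N}_{G/S}(F)/F\,\mathrm{C}_{G/S}(F)$ is soluble for each simple factor $F$ of $R/S$. -/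

import Mathlib

universe u

namespace HJI

section Profinite

variable (G : Type u) [Group G] [TopologicalSpace G]

/-- A profinite group `G` is just infinite if it is infinite and each of its nontrivial (closed)
normal subgroups has finite index. -/
def JustInfinite : Prop :=
  Infinite G ∧ ∀ N : Subgroup G, N.Normal → IsClosed (N : Set G) → N ≠ ⊥ → N.FiniteIndex

/-- `G` is hereditarily just infinite if it is just infinite and so are all its open subgroups. -/
def HereditarilyJustInfinite : Prop :=
  JustInfinite G ∧ ∀ U : Subgroup G, IsOpen (U : Set G) → JustInfinite U

/-- A profinite group is prosoluble if all its quotients by open normal subgroups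
(which are finite groups) are soluble. -/
def Prosoluble : Prop :=
  ∀ (N : Subgroup G) [N.Normal], IsOpen (N : Set G) → Group.IsSolvable (G ⧸ N)

/-- A profinite group is virtually prosoluble if it has an open prosoluble subgroup. -/
def VirtuallyProsoluble : Prop :=
  ∃ U : Subgroup G, IsOpen (U : Set G) ∧ Prosoluble U

/-- The Mel'nikov subgroup (cosocle) `M(G)`: the intersection of all maximal open normal subgroups
of `G`, that is, of all maximal members of the set of proper open normal subgroups. -/
def melnikov : Subgroup G :=
  sInf {N : Subgroup G |
    Maximal (fun L : Subgroup G => L.Normal ∧ IsOpen (L : Set G) ∧ L ≠ ⊤) N}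

variable {G}

/-- `R / S` is a chief factor of `G`: `S < R` are closed normal subgroups of `G`, with no closed
normal subgroup of `G` strictly between them. -/
def IsChiefFactor (R S : Subgroup G) : Prop :=
  R.Normal ∧ IsClosed (R : Set G) ∧ S.Normal ∧ IsClosed (S : Set G) ∧ S < R ∧
    ∀ M : Subgroup G, M.Normal → IsClosed (M : Set G) → S < M → ¬ M < R

end Profinite

/-- The action of `G` on `X` (with kernel `K`) is subprimitive: for every normal subgroup `H` of
`G`, the group `H / (H ∩ K)` acts faithfully on every `H`-orbit, that is, any `h ∈ H` fixing some
`H`-orbit pointwise acts trivially on `X`. -/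
def IsSubprimitive (G : Type*) (X : Type*) [Group G] [MulAction G X] : Prop :=
  ∀ H : Subgroup G, H.Normal → ∀ x : X, ∀ h ∈ H,
    (∀ y ∈ MulAction.orbit H x, h • y = y) → ∀ z : X, h • z = z

section Factors

variable {G : Type u} [Group G]

/-- The subgroup `F` is a nonabelian simple group. -/
def IsNonabelianSimple (F : Subgroup G) : Prop :=
  IsSimpleGroup F ∧ ∃ x ∈ F, ∃ y ∈ F, x * y ≠ y * x

/-- `P` is an (internal) direct product of nonabelian simple groups. -/
def IsProductOfNonabelianSimple (P : Subgroup G) : Prop :=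
  ∃ Ω : Set (Subgroup G), (∀ F ∈ Ω, IsNonabelianSimple F) ∧
    (∀ F ∈ Ω, ∀ E ∈ Ω, F ≠ E → ∀ x ∈ F, ∀ y ∈ E, x * y = y * x) ∧
    sSupIndep Ω ∧ sSup Ω = P

/-- The simple factors of `P`: the nonabelian simple normal subgroups of `P`. If `P` is a direct
product of finitely many nonabelian simple groups, these are exactly the direct factors in that
decomposition. -/
def SimpleFactor (P : Subgroup G) : Type u :=
  {F : Subgroup G // F ≤ P ∧ P ≤ Subgroup.normalizer (F : Set G) ∧ IsNonabelianSimple F}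

theorem simpleFactor_conj (P : Subgroup G) [hP : P.Normal] (g : G) (F : Subgroup G)
    (hF : F ≤ P ∧ P ≤ Subgroup.normalizer (F : Set G) ∧ IsNonabelianSimple F) :
    F.map (MulAut.conj g).toMonoidHom ≤ P ∧
      P ≤ Subgroup.normalizer (F.map (MulAut.conj g).toMonoidHom : Set G) ∧
      IsNonabelianSimple (F.map (MulAut.conj g).toMonoidHom) := by
  obtain ⟨h1, h2, hs, x, hx, y, hy, hxy⟩ := hF
  refine ⟨?_, ?_, ?_, ?_⟩
  · rintro _ ⟨f, hf, rfl⟩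
    exact hP.conj_mem f (h1 hf) g
  · rw [Subgroup.le_normalizer_iff] at h2 ⊢
    rintro p hp _ ⟨f, hf, rfl⟩
    refine ⟨(g⁻¹ * p * g) * f * (g⁻¹ * p * g)⁻¹, h2 _ ?_ f hf, ?_⟩
    · simpa using hP.conj_mem p hp g⁻¹
    · simp [mul_assoc]
  · exact (F.equivMapOfInjective _ (MulAut.conj g).injective).symm.isSimpleGroup
  · refine ⟨_, Subgroup.mem_map_of_mem _ hx, _, Subgroup.mem_map_of_mem _ hy, ?_⟩
    rw [← map_mul, ← map_mul]
    exact fun h => hxy ((MulAut.conj g).injective h)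

/-- `G` acts by conjugation, `g • F = g F g⁻¹`, on the simple factors of a normal subgroup. -/
instance (P : Subgroup G) [P.Normal] : MulAction G (SimpleFactor P) where
  smul g F := ⟨F.1.map (MulAut.conj g).toMonoidHom, simpleFactor_conj P g F.1 F.2⟩
  one_smul F := Subtype.ext (by
    change F.1.map (MulAut.conj (1 : G)).toMonoidHom = F.1
    rw [map_one]
    exact Subgroup.map_id F.1)
  mul_smul g h F := Subtype.ext (by
    change F.1.map (MulAut.conj (g * h)).toMonoidHom =
      (F.1.map (MulAut.conj h).toMonoidHom).map (MulAut.conj g).toMonoidHom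
    rw [map_mul, Subgroup.map_map]
    rfl)

/-- `F C_G(F)` is a normal subgroup of `N_G(F)`. -/
instance (F : Subgroup G) :
    ((F ⊔ Subgroup.centralizer (F : Set G)).subgroupOf
      (Subgroup.normalizer (F : Set G))).Normal := by
  rw [Subgroup.subgroupOf_sup Subgroup.le_normalizer (Subgroup.centralizer_le_normalizer _)]
  infer_instance

/-- The group `N_G(F) / F C_G(F)` of outer automorphisms of `F` induced by `G`. -/
abbrev InducedOut (F : Subgroup G) : Type u :=
  Subgroup.normalizer (F : Set G) ⧸
    (F ⊔ Subgroup.centralizer (F : Set G)).subgroupOf (Subgroup.normalizer (F : Set G))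

/-- `G` permutes the simple factors of its normal subgroup `P` subprimitively by conjugation, and
induces a soluble group of outer automorphisms on each of them. -/
def SubprimitiveFactors (P : Subgroup G) [P.Normal] : Prop :=
  IsSubprimitive G (SimpleFactor P) ∧ ∀ F : SimpleFactor P, Group.IsSolvable (InducedOut F.1)

/-- The image `R / S` of `R` in `G / S`. -/
abbrev quotientSubgroup (R S : Subgroup G) [S.Normal] : Subgroup (G ⧸ S) :=
  R.map (QuotientGroup.mk' S)

instance (R S : Subgroup G) [R.Normal] [S.Normal] : (quotientSubgroup R S).Normal :=
  Subgroup.Normal.map ‹_› _ (QuotientGroup.mk'_surjective S)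

end Factors

/-- The condition: `G` is just infinite, and has infinitely many nonabelian chief factors `R / S`
whose simple factors are permuted subprimitively by conjugation in `G / S`, with a soluble group
of induced outer automorphisms on each simple factor. -/
def HasManySubprimitiveFactors (G : Type u) [Group G] [TopologicalSpace G] : Prop :=
  JustInfinite G ∧
  {RS : Subgroup G × Subgroup G | IsChiefFactor RS.1 RS.2 ∧
    ∃ (_ : RS.1.Normal) (_ : RS.2.Normal),
      (∃ x ∈ quotientSubgroup RS.1 RS.2, ∃ y ∈ quotientSubgroup RS.1 RS.2, x * y ≠ y * x) ∧
      SubprimitiveFactors (quotientSubgroup RS.1 RS.2)}.Infinite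

/-- An inverse system of finite groups indexed by `ℕ`, with surjective maps `ρ n`. -/
structure InverseSystem where
  /-- the groups -/
  G : ℕ → Type u
  [group : ∀ n, Group (G n)]
  [finite : ∀ n, Finite (G n)]
  /-- the connecting maps -/
  ρ : ∀ n, G (n + 1) →* G n
  surj : ∀ n, Function.Surjective (ρ n)

namespace InverseSystem

attribute [instance] InverseSystem.group InverseSystem.finite

variable (Λ : InverseSystem.{u})

/-- The finite groups of the system carry the discrete topology. -/
instance (n : ℕ) : TopologicalSpace (Λ.G n) := ⊥

instance (n : ℕ) : DiscreteTopology (Λ.G n) := ⟨rfl⟩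

/-- The inverse limit, as a subgroup of the product, with the subspace topology. -/
def limit : Subgroup (∀ n, Λ.G n) where
  carrier := {x | ∀ n, Λ.ρ n (x (n + 1)) = x n}
  one_mem' n := map_one _
  mul_mem' hx hy n := by simp [hx n, hy n]
  inv_mem' hx n := by simp [hx n]

variable (A : ∀ n, Subgroup (Λ.G n))

/-- `P n = ρ n (A (n + 1))`. -/
def P (n : ℕ) : Subgroup (Λ.G n) := (A (n + 1)).map (Λ.ρ n)

instance [h : ∀ n, (A n).Normal] (n : ℕ) : (Λ.P A n).Normal :=
  (h (n + 1)).map _ (Λ.surj n)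

/-- The conditions on the normal subgroups `A n`, at the index `n`:
`M(A (n + 1)) = ker (ρ n) ≥ P (n + 1)`; `A n > C(P n)`; `P n` is a direct product of nonabelian
simple groups that are permuted subprimitively by `G n`, with soluble groups of induced outer
automorphisms. -/
structure ConditionsAt [∀ n, (A n).Normal] (n : ℕ) : Prop where
  melnikov_eq : (melnikov (A (n + 1))).map (A (n + 1)).subtype = (Λ.ρ n).ker
  P_le : Λ.P A (n + 1) ≤ (Λ.ρ n).ker
  centralizer_lt : Subgroup.centralizer (Λ.P A n : Set (Λ.G n)) < A n
  product : IsProductOfNonabelianSimple (Λ.P A n)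
  subprimitive : SubprimitiveFactors (Λ.P A n)

end InverseSystem

end HJI

/-! Forward direction. Because the kernel of `ρ n` is `M(A (n+1))`, a normal subgroup of `G (n+1)`
whose image contains `P n` must contain `A (n+1)`. So if the image of a closed normal subgroup `N`
of the limit contains `P n` once, the images contain every later `A m`, hence every later kernel,
and `N` is open. Otherwise subprimitivity makes each image of `N` fix all simple factors; solubility
of the induced outer automorphisms puts a derived term of the image inside `P C(P) ≤ A`, which dies
two levels down. The images are then soluble, so they centralise `P n`, lie in `A n`, and die in
turn (`map_proj_eq_bot`).

For `N` normalised only by an open subgroup, one passes to an intersection of conjugates whose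
distinct conjugates meet trivially and therefore commute. If there is more than one conjugate, some
conjugate covers a simple factor and another centralises it; subprimitivity, applied to the normal
subgroup they generate, makes `A` fix every factor. This is impossible (`not_le_factorKernel`),
since `A` would then be perfect modulo the wrong subgroup and collapse to `C(P)`. Virtual
prosolubility fails because the images of an open subgroup contain nonabelian simple factors.

Converse. In a just infinite profinite group an open subgroup contains all but finitely many closed
normal subgroups, and only finitely many nonabelian chief factors share a given centraliser.
Infinitely many chief factors therefore supply centralisers inside any open subgroup. Each `R/S` is
replaced by an isomorphic factor `X/T` with `X` minimal subject to not lying in `S`. Choosing such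
factors ever deeper, one sets `G n = G/T n` and `A (n+1) = X n/T (n+1)`; minimality of `X` yields
`M(A (n+1)) = ker (ρ n)`. -/

namespace HJI

open scoped commutatorElement

/-! ### Derived series inside an ambient group -/

section DerivedSubgroup

variable {G H : Type*} [Group G] [Group H]

/-- The derived series of a subgroup, as a sequence of subgroups of the ambient group. -/
def derivedSubgroup (K : Subgroup G) : ℕ → Subgroup G
  | 0 => K
  | n + 1 => ⁅derivedSubgroup K n, derivedSubgroup K n⁆

theorem derivedSubgroup_map (f : G →* H) (K : Subgroup G) (n : ℕ) :
    (derivedSubgroup K n).map f = derivedSubgroup (K.map f) n := by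
  induction n with
  | zero => rfl
  | succ n ih => simp only [derivedSubgroup, Subgroup.map_commutator, ih]

theorem derivedSubgroup_mono {K L : Subgroup G} (h : K ≤ L) (n : ℕ) :
    derivedSubgroup K n ≤ derivedSubgroup L n := by
  induction n with
  | zero => exact h
  | succ n ih => exact Subgroup.commutator_mono ih ih

theorem derivedSubgroup_normal (K : Subgroup G) [hK : K.Normal] (n : ℕ) :
    (derivedSubgroup K n).Normal := by
  induction n with
  | zero => exact hK
  | succ n ih => exact Subgroup.commutator_normal _ _

theorem commutator_self_le (K : Subgroup G) : ⁅K, K⁆ ≤ K := by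
  rw [Subgroup.commutator_le]
  exact fun x hx y hy => K.mul_mem (K.mul_mem (K.mul_mem hx hy) (K.inv_mem hx)) (K.inv_mem hy)

theorem derivedSubgroup_antitone (K : Subgroup G) : Antitone (derivedSubgroup K) :=
  antitone_nat_of_succ_le fun _ => commutator_self_le _

theorem derivedSubgroup_top (n : ℕ) : derivedSubgroup (⊤ : Subgroup G) n = derivedSeries G n := by
  induction n with
  | zero => rfl
  | succ n ih => simp only [derivedSubgroup, derivedSeries_succ, ih]

theorem map_subtype_derivedSeries (K : Subgroup G) (n : ℕ) :
    (derivedSeries K n).map K.subtype = derivedSubgroup K n := by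
  rw [← derivedSubgroup_top, derivedSubgroup_map, ← MonoidHom.range_eq_map, Subgroup.range_subtype]

theorem derivedSubgroup_le_of_isSolvable {K L : Subgroup G} [(L.subgroupOf K).Normal]
    [Group.IsSolvable (K ⧸ L.subgroupOf K)] : ∃ n, derivedSubgroup K n ≤ L := by
  obtain ⟨n, hn⟩ := ‹Group.IsSolvable (K ⧸ L.subgroupOf K)›
  refine ⟨n, ?_⟩
  have h := map_derivedSeries_le_derivedSeries (QuotientGroup.mk' (L.subgroupOf K)) n
  rw [hn, le_bot_iff, Subgroup.map_eq_bot_iff, QuotientGroup.ker_mk'] at h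
  rw [← map_subtype_derivedSeries, Subgroup.map_le_iff_le_comap]
  exact h

theorem derivedSubgroup_eq_of_perfect {K : Subgroup G} (h : ⁅K, K⁆ = K) (n : ℕ) :
    derivedSubgroup K n = K := by
  induction n with
  | zero => rfl
  | succ n ih => rw [derivedSubgroup, ih, h]

end DerivedSubgroup

/-! ### Simple factors of a normal subgroup and the action on them -/

section SimpleFactors

variable {G : Type u} [Group G]

theorem IsNonabelianSimple.disjoint_or_le {F : Subgroup G} (hF : IsNonabelianSimple F)
    {L : Subgroup G} (hL : ∀ x ∈ F, ∀ y ∈ L, y ∈ F → x * y * x⁻¹ ∈ L) : Disjoint L F ∨ F ≤ L := by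
  have := hF.1
  have hn : (L.subgroupOf F).Normal := by
    refine ⟨fun y hy x => ?_⟩
    rw [Subgroup.mem_subgroupOf] at hy ⊢
    exact hL x x.2 y hy y.2
  rcases hn.eq_bot_or_eq_top with h | h
  · exact Or.inl (Subgroup.subgroupOf_eq_bot.1 h)
  · exact Or.inr (Subgroup.subgroupOf_eq_top.1 h)

theorem IsNonabelianSimple.commutator_eq {F : Subgroup G} (hF : IsNonabelianSimple F) :
    ⁅F, F⁆ = F := by
  obtain ⟨x, hx, y, hy, hxy⟩ := hF.2
  refine le_antisymm (commutator_self_le F) ?_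
  have hn : ∀ f ∈ F, ∀ c ∈ ⁅F, F⁆, c ∈ F → f * c * f⁻¹ ∈ ⁅F, F⁆ := by
    intro f hf c hc hcF
    have : f * c * f⁻¹ = ⁅f, c⁆ * c := by simp [commutatorElement_def]
    rw [this]
    exact Subgroup.mul_mem _ (Subgroup.commutator_mem_commutator hf hcF) hc
  rcases hF.disjoint_or_le hn with h | h
  · exfalso
    have h1 : ⁅x, y⁆ ∈ ⁅F, F⁆ := Subgroup.commutator_mem_commutator hx hy
    have := Subgroup.disjoint_def.1 h h1 (commutator_self_le F h1)
    exact hxy (commutatorElement_eq_one_iff_mul_comm.1 this)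
  · exact h

theorem IsNonabelianSimple.ne_bot {F : Subgroup G} (hF : IsNonabelianSimple F) : F ≠ ⊥ := by
  rintro rfl
  obtain ⟨x, hx, y, hy, hxy⟩ := hF.2
  rw [Subgroup.mem_bot] at hx hy
  exact hxy (by rw [hx, hy])

theorem SimpleFactor.conj_mem {P : Subgroup G} (F : SimpleFactor P) {p x : G} (hp : p ∈ P)
    (hx : x ∈ F.1) : p * x * p⁻¹ ∈ F.1 :=
  Subgroup.le_normalizer_iff.1 F.2.2.1 p hp x hx

theorem SimpleFactor.eq_of_le {P : Subgroup G} {F E : SimpleFactor P} (h : F.1 ≤ E.1) : F = E := by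
  refine Subtype.ext (le_antisymm h ?_)
  rcases E.2.2.2.disjoint_or_le (L := F.1) fun x hx y hy _ => F.conj_mem (E.2.1 hx) hy with h1 | h1
  · exact absurd (le_bot_iff.1 (h1 le_rfl h)) F.2.2.2.ne_bot
  · exact h1

theorem SimpleFactor.commute_of_ne {P : Subgroup G} {F E : SimpleFactor P} (hne : F ≠ E)
    {x y : G} (hx : x ∈ F.1) (hy : y ∈ E.1) : x * y = y * x := by
  have hd : Disjoint F.1 E.1 := by
    rcases E.2.2.2.disjoint_or_le (L := F.1) fun x hx y hy _ => F.conj_mem (E.2.1 hx) hy with h | h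
    · exact h
    · exact absurd (SimpleFactor.eq_of_le h).symm hne
  rw [← commutatorElement_eq_one_iff_mul_comm]
  refine Subgroup.disjoint_def.1 hd ?_ ?_
  · have : ⁅x, y⁆ = x * (y * x⁻¹ * y⁻¹) := by simp [commutatorElement_def, mul_assoc]
    rw [this]
    exact F.1.mul_mem hx (F.conj_mem (E.2.1 hy) (F.1.inv_mem hx))
  · exact E.1.mul_mem (E.conj_mem (F.2.1 hx) hy) (E.1.inv_mem hy)

theorem SimpleFactor.conj_mem_smul {P : Subgroup G} [P.Normal] (g : G) (F : SimpleFactor P)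
    {x : G} (hx : x ∈ F.1) : g * x * g⁻¹ ∈ (g • F).1 := ⟨x, hx, rfl⟩

theorem SimpleFactor.conj_mem_of_smul_eq {P : Subgroup G} [P.Normal] {g : G} {F : SimpleFactor P}
    (h : g • F = F) {x : G} (hx : x ∈ F.1) : g * x * g⁻¹ ∈ F.1 :=
  h ▸ F.conj_mem_smul g hx

theorem SimpleFactor.smul_eq_of_commute {P : Subgroup G} [P.Normal] {g : G} {F : SimpleFactor P}
    (h : ∀ x ∈ F.1, g * x = x * g) : g • F = F := by
  refine SimpleFactor.eq_of_le ?_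
  rintro _ ⟨x, hx, rfl⟩
  change g * x * g⁻¹ ∈ F.1
  rwa [h x hx, mul_inv_cancel_right]

/-- A subgroup normalised by a simple factor contains the factor or centralises it. -/
theorem SimpleFactor.le_or_commute {P : Subgroup G} [hP : P.Normal] (F : SimpleFactor P)
    {J : Subgroup G} (hJ : ∀ x ∈ F.1, ∀ y ∈ J, x * y * x⁻¹ ∈ J) :
    F.1 ≤ J ∨ ∀ h ∈ J, ∀ x ∈ F.1, h * x = x * h := by
  rcases F.2.2.2.disjoint_or_le (L := J) fun x hx y hy _ => hJ x hx y hy with hd | hd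
  · right
    have hcomm : ∀ y ∈ J, y ∈ P → ∀ x ∈ F.1, x * y = y * x := by
      intro y hy hyP x hx
      rw [← commutatorElement_eq_one_iff_mul_comm]
      refine Subgroup.disjoint_def.1 hd ?_ ?_
      · exact J.mul_mem (hJ x hx y hy) (J.inv_mem hy)
      · have : ⁅x, y⁆ = x * (y * x⁻¹ * y⁻¹) := by simp [commutatorElement_def, mul_assoc]
        rw [this]
        exact F.1.mul_mem hx (F.conj_mem hyP (F.1.inv_mem hx))
    have hmem : ∀ h ∈ J, ∀ x ∈ F.1, ⁅h, x⁆ ∈ J := by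
      intro h hh x hx
      have : ⁅h, x⁆ = h * (x * h⁻¹ * x⁻¹) := by simp [commutatorElement_def, mul_assoc]
      rw [this]
      exact J.mul_mem hh (hJ x hx _ (J.inv_mem hh))
    have hmemP : ∀ h ∈ J, ∀ x ∈ F.1, ⁅h, x⁆ ∈ P := fun h _ x hx =>
      P.mul_mem (hP.conj_mem x (F.2.1 hx) h) (P.inv_mem (F.2.1 hx))
    intro h hh
    have hfix : h • F = F := by
      -- If `h` moved `F`, then both `h a h⁻¹` and `⁅h, a⁆` would commute with all of `F`, and so
      -- would their quotient `a`.
      by_contra hne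
      obtain ⟨a, ha, b, hb, hab⟩ := F.2.2.2.2
      apply hab
      have h1 := SimpleFactor.commute_of_ne hne (F.conj_mem_smul h ha) hb
      have h2 := hcomm _ (hmem h hh a ha) (hmemP h hh a ha) b hb
      have h3 : h * a * h⁻¹ = ⁅h, a⁆ * a := by simp [commutatorElement_def]
      rw [h3, mul_assoc, ← mul_assoc b, h2, mul_assoc] at h1
      exact mul_left_cancel h1
    intro x hx
    rw [← commutatorElement_eq_one_iff_mul_comm]
    exact Subgroup.disjoint_def.1 hd (hmem h hh x hx)
      (F.1.mul_mem (SimpleFactor.conj_mem_of_smul_eq hfix hx) (F.1.inv_mem hx))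
  · exact Or.inl hd

theorem IsProductOfNonabelianSimple.le_iSup_factors {P : Subgroup G}
    (hP : IsProductOfNonabelianSimple P) : P ≤ ⨆ F : SimpleFactor P, F.1 := by
  obtain ⟨Ω, hs, hc, -, rfl⟩ := hP
  refine sSup_le fun F hF => ?_
  have : F ≤ sSup Ω ∧ sSup Ω ≤ Subgroup.normalizer (F : Set G) ∧ IsNonabelianSimple F := by
    refine ⟨le_sSup hF, sSup_le fun E hE => ?_, hs F hF⟩
    by_cases h : F = E
    · rw [h]; exact Subgroup.le_normalizer
    · rw [Subgroup.le_normalizer_iff]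
      intro y hy x hx
      rwa [← hc F hF E hE h x hx y hy, mul_inv_cancel_right]
  exact le_iSup (fun F : SimpleFactor (sSup Ω) => F.1) ⟨F, this⟩

theorem IsProductOfNonabelianSimple.commutator_eq {P : Subgroup G}
    (hP : IsProductOfNonabelianSimple P) : ⁅P, P⁆ = P := by
  refine le_antisymm (commutator_self_le P) (hP.le_iSup_factors.trans (iSup_le fun F => ?_))
  rw [← F.2.2.2.commutator_eq]
  exact Subgroup.commutator_mono F.2.1 F.2.1

theorem IsProductOfNonabelianSimple.mem_centralizer {P : Subgroup G}
    (hP : IsProductOfNonabelianSimple P) {g : G}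
    (h : ∀ F : SimpleFactor P, ∀ x ∈ F.1, g * x = x * g) :
    g ∈ Subgroup.centralizer (P : Set G) := by
  have : P ≤ Subgroup.centralizer {g} := hP.le_iSup_factors.trans (iSup_le fun F x hx => by
    rw [Subgroup.mem_centralizer_singleton_iff]
    exact (h F x hx).symm)
  rw [Subgroup.mem_centralizer_iff]
  intro p hp
  exact Subgroup.mem_centralizer_singleton_iff.1 (this hp)

instance [Finite G] (P : Subgroup G) : Finite (SimpleFactor P) :=
  inferInstanceAs (Finite {F : Subgroup G // _})

/-- The element `k` acts on each factor in `s` as an inner automorphism. The corresponding elements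
of the factors can be corrected one at a time, since distinct factors commute. -/
theorem exists_inv_mul_mem_centralizer {P : Subgroup G} (s : Finset (SimpleFactor P)) {k : G}
    (hk : ∀ F ∈ s, k ∈ F.1 ⊔ Subgroup.centralizer (F.1 : Set G)) :
    ∃ p ∈ ⨆ F ∈ s, F.1, ∀ F ∈ s, p⁻¹ * k ∈ Subgroup.centralizer (F.1 : Set G) := by
  classical
  induction s using Finset.induction_on with
  | empty => exact ⟨1, Subgroup.one_mem _, by simp⟩
  | insert E s hE ih =>
    obtain ⟨p, hp, hpc⟩ := ih fun F hF => hk F (Finset.mem_insert_of_mem hF)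
    obtain ⟨f, hf, c, hc, rfl⟩ : ∃ f ∈ E.1, ∃ c ∈ Subgroup.centralizer (E.1 : Set G), f * c = k := by
      have h := hk E (Finset.mem_insert_self _ _)
      rw [← SetLike.mem_coe, Subgroup.coe_mul_of_right_le_normalizer_left _ _
        (Subgroup.centralizer_le_normalizer _)] at h
      exact h
    have hpE : p ∈ Subgroup.centralizer (E.1 : Set G) := by
      refine (iSup₂_le fun F hF x hx => ?_ : ⨆ F ∈ s, F.1 ≤ _) hp
      rw [Subgroup.mem_centralizer_iff]
      intro e he
      exact SimpleFactor.commute_of_ne (ne_of_mem_of_not_mem hF hE).symm he hx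
    have hpf : f * p = p * f := Subgroup.mem_centralizer_iff.1 hpE f hf
    refine ⟨p * f, Subgroup.mul_mem _ ?_ ?_, ?_⟩
    · exact (biSup_mono fun _ hF => Finset.mem_insert_of_mem hF :
        ⨆ F ∈ s, F.1 ≤ ⨆ F ∈ insert E s, F.1) hp
    · exact (le_biSup (fun F : SimpleFactor P => F.1) (Finset.mem_insert_self E s)) hf
    · intro F hF
      rcases Finset.mem_insert.1 hF with rfl | hF
      · have : (p * f)⁻¹ * (f * c) = p⁻¹ * c := by rw [← hpf]; group
        rw [this]
        exact Subgroup.mul_mem _ (Subgroup.inv_mem _ hpE) hc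
      · have : (p * f)⁻¹ * (f * c) = f⁻¹ * (p⁻¹ * (f * c)) := by group
        rw [this]
        refine Subgroup.mul_mem _ (Subgroup.inv_mem _ ?_) (hpc F hF)
        rw [Subgroup.mem_centralizer_iff]
        intro e he
        exact SimpleFactor.commute_of_ne (ne_of_mem_of_not_mem hF hE) he hf

theorem IsProductOfNonabelianSimple.iInf_sup_centralizer_le [Finite G] {P : Subgroup G}
    (hP : IsProductOfNonabelianSimple P) :
    ⨅ F : SimpleFactor P, (F.1 ⊔ Subgroup.centralizer (F.1 : Set G)) ≤
      P ⊔ Subgroup.centralizer (P : Set G) := by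
  intro k hk
  rw [Subgroup.mem_iInf] at hk
  have := Fintype.ofFinite (SimpleFactor P)
  obtain ⟨p, hp, hpc⟩ := exists_inv_mul_mem_centralizer Finset.univ fun F _ => hk F
  have hle : ⨆ F ∈ (Finset.univ : Finset (SimpleFactor P)), F.1 ≤ P := iSup₂_le fun E _ => E.2.1
  have hc : p⁻¹ * k ∈ Subgroup.centralizer (P : Set G) := hP.mem_centralizer fun F x hx =>
    (Subgroup.mem_centralizer_iff.1 (hpc F (Finset.mem_univ _)) x hx).symm
  have h := Subgroup.mul_mem_sup (hle hp) hc
  rwa [mul_inv_cancel_left] at h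

/-- The kernel of the action of `G` on the simple factors of `P`. -/
abbrev factorKernel (P : Subgroup G) [P.Normal] : Subgroup G :=
  (MulAction.toPermHom G (SimpleFactor P)).ker

theorem mem_factorKernel {P : Subgroup G} [P.Normal] {g : G} :
    g ∈ factorKernel P ↔ ∀ F : SimpleFactor P, g • F = F := by
  rw [MonoidHom.mem_ker, Equiv.ext_iff]
  rfl

/-- The kernel normalises every factor, and modulo `P C(P)` it embeds in the product of the finitely
many soluble groups `InducedOut F`. -/
theorem exists_derivedSubgroup_factorKernel_le [Finite G] {P : Subgroup G} [P.Normal]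
    (hP : IsProductOfNonabelianSimple P)
    (hs : ∀ F : SimpleFactor P, Group.IsSolvable (InducedOut F.1)) :
    ∃ n, derivedSubgroup (factorKernel P) n ≤ P ⊔ Subgroup.centralizer (P : Set G) := by
  have := Fintype.ofFinite (SimpleFactor P)
  have h : ∀ F : SimpleFactor P, ∃ n,
      derivedSubgroup (factorKernel P) n ≤ F.1 ⊔ Subgroup.centralizer (F.1 : Set G) := by
    intro F
    have := hs F
    obtain ⟨n, hn⟩ := derivedSubgroup_le_of_isSolvable
      (K := Subgroup.normalizer (F.1 : Set G)) (L := F.1 ⊔ Subgroup.centralizer (F.1 : Set G))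
    refine ⟨n, (derivedSubgroup_mono ?_ n).trans hn⟩
    intro k hk
    rw [Subgroup.mem_normalizer_iff_map_conj_eq]
    exact congrArg Subtype.val (mem_factorKernel.1 hk F)
  choose d hd using h
  refine ⟨Finset.univ.sup d, le_trans (le_iInf fun F => ?_) hP.iInf_sup_centralizer_le⟩
  exact (derivedSubgroup_antitone _ (Finset.le_sup (Finset.mem_univ F))).trans (hd F)

/-- If the simple factors of `P` are permuted subprimitively, then every normal subgroup contains
`P` or fixes all the simple factors. -/
theorem SubprimitiveFactors.le_or_le_factorKernel {P : Subgroup G} [P.Normal]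
    (hP : IsProductOfNonabelianSimple P) (hs : SubprimitiveFactors P) (H : Subgroup G)
    [hH : H.Normal] : P ≤ H ∨ H ≤ factorKernel P := by
  by_cases h : ∀ F : SimpleFactor P, F.1 ≤ H
  · exact Or.inl (hP.le_iSup_factors.trans (iSup_le h))
  · right
    push Not at h
    obtain ⟨F, hF⟩ := h
    have hc := (F.le_or_commute (J := H) fun x _ y hy => hH.conj_mem y hy x).resolve_left hF
    have hfix : ∀ h ∈ H, h • F = F := fun h hh => SimpleFactor.smul_eq_of_commute (hc h hh)
    intro h hh
    rw [mem_factorKernel]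
    -- As `H` centralises `F`, the `H`-orbit of `F` is a single point, so faithfulness on it says
    -- that `H` acts trivially.
    refine hs.1 H hH F h hh ?_
    rintro _ ⟨g, rfl⟩
    change h • (g.1 • F) = g.1 • F
    rw [hfix _ g.2, hfix _ hh]

end SimpleFactors

/-- A Frattini-type property: a proper `B` lies in a maximal normal subgroup of `A`, which also
contains `M(A)`. -/
theorem eq_of_le_sup_melnikov {G : Type*} [Group G] [Finite G] {A B : Subgroup G}
    [TopologicalSpace A] [DiscreteTopology A] [hB : B.Normal] (hBA : B ≤ A)
    (h : A ≤ B ⊔ (melnikov A).map A.subtype) : B = A := by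
  by_contra hne
  have hB' : (B.subgroupOf A).Normal := inferInstance
  have hmem : B.subgroupOf A ∈
      {L : Subgroup A | L.Normal ∧ IsOpen (L : Set A) ∧ L ≠ ⊤} :=
    ⟨hB', isOpen_discrete _, fun h => hne (le_antisymm hBA (Subgroup.subgroupOf_eq_top.1 h))⟩
  obtain ⟨M, hBM, hM⟩ := (Set.toFinite _).exists_le_maximal hmem
  have hmel : melnikov A ≤ M := sInf_le hM
  apply hM.prop.2.2
  rw [eq_top_iff, ← Subgroup.map_subtype_le_map_subtype, ← MonoidHom.range_eq_map,
    Subgroup.range_subtype]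
  refine h.trans (sup_le ?_ (Subgroup.map_mono hmel))
  rw [← inf_eq_left.2 hBA, ← Subgroup.subgroupOf_map_subtype]
  exact Subgroup.map_mono hBM

namespace InverseSystem

variable (Λ : InverseSystem.{u})

/-! ### The inverse limit and its projections -/

section Projections

/-- The projections of the inverse limit. -/
def proj (n : ℕ) : Λ.limit →* Λ.G n := (Pi.evalMonoidHom Λ.G n).comp Λ.limit.subtype

theorem ρ_comp_proj (n : ℕ) : (Λ.ρ n).comp (Λ.proj (n + 1)) = Λ.proj n :=
  MonoidHom.ext fun x => x.2 n

theorem ρ_proj (n : ℕ) (x : Λ.limit) : Λ.ρ n (Λ.proj (n + 1) x) = Λ.proj n x := x.2 n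

theorem continuous_proj (n : ℕ) : Continuous (Λ.proj n) :=
  (continuous_apply n).comp continuous_subtype_val

/-- The system without its first group. -/
abbrev shift : InverseSystem.{u} where
  G n := Λ.G (n + 1)
  ρ n := Λ.ρ (n + 1)
  surj n := Λ.surj (n + 1)

/-- Coordinates above the given one are chosen as successive preimages; those below are forced, and
are restored by removing the first group of the system one step at a time. -/
theorem proj_surjective (n : ℕ) : Function.Surjective (Λ.proj n) := by
  induction n generalizing Λ with
  | zero =>
    intro g
    let x : ∀ n, Λ.G n := fun n => Nat.rec g (fun n y => (Λ.surj n y).choose) n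
    exact ⟨⟨x, fun n => (Λ.surj n (x n)).choose_spec⟩, rfl⟩
  | succ n ih =>
    intro g
    obtain ⟨⟨x, hx⟩, rfl⟩ := ih Λ.shift g
    let y : ∀ n, Λ.G n := fun n => match n with
      | 0 => Λ.ρ 0 (x 0)
      | n + 1 => x n
    refine ⟨⟨y, fun n => ?_⟩, rfl⟩
    cases n with
    | zero => rfl
    | succ n => exact hx n

theorem proj_eq_of_le {m n : ℕ} (h : m ≤ n) {x y : Λ.limit} (hxy : Λ.proj n x = Λ.proj n y) :
    Λ.proj m x = Λ.proj m y := by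
  induction n, h using Nat.le_induction with
  | base => exact hxy
  | succ n _ ih => exact ih (by rw [← ρ_proj, hxy, ρ_proj])

theorem exists_forall_proj_eq_mem {U : Set Λ.limit} (hU : IsOpen U) {x : Λ.limit} (hx : x ∈ U) :
    ∃ m, ∀ n ≥ m, ∀ y, Λ.proj n y = Λ.proj n x → y ∈ U := by
  obtain ⟨V, hV, rfl⟩ := isOpen_induced_iff.1 hU
  obtain ⟨I, u, hu, hIV⟩ := isOpen_pi_iff.1 hV x.1 hx
  refine ⟨I.sup id, fun n hn y hy => hIV fun k hk => ?_⟩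
  have : y.1 k = x.1 k := Λ.proj_eq_of_le ((Finset.le_sup (f := id) hk).trans hn) hy
  rw [this]
  exact (hu k hk).2

theorem exists_ker_proj_le {U : Subgroup Λ.limit} (hU : IsOpen (U : Set Λ.limit)) :
    ∃ m, ∀ n ≥ m, (Λ.proj n).ker ≤ U := by
  obtain ⟨m, hm⟩ := Λ.exists_forall_proj_eq_mem hU U.one_mem
  exact ⟨m, fun n hn y hy => hm n hn y (by rw [map_one]; exact hy)⟩

theorem mem_of_forall_proj_mem {N : Subgroup Λ.limit} (hN : IsClosed (N : Set Λ.limit)) {k : ℕ}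
    {x : Λ.limit} (h : ∀ n ≥ k, Λ.proj n x ∈ N.map (Λ.proj n)) : x ∈ N := by
  by_contra hx
  obtain ⟨m, hm⟩ := Λ.exists_forall_proj_eq_mem hN.isOpen_compl hx
  obtain ⟨y, hy, hxy⟩ := h (max m k) (le_max_right _ _)
  exact hm _ (le_max_left _ _) y hxy hy

theorem isOpen_ker_proj (n : ℕ) : IsOpen ((Λ.proj n).ker : Set Λ.limit) := by
  have : ((Λ.proj n).ker : Set Λ.limit) = Λ.proj n ⁻¹' {1} := rfl
  rw [this]
  exact (isOpen_discrete _).preimage (Λ.continuous_proj n)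

theorem map_proj_map_ρ (N : Subgroup Λ.limit) (n : ℕ) :
    (N.map (Λ.proj (n + 1))).map (Λ.ρ n) = N.map (Λ.proj n) := by
  rw [Subgroup.map_map, ρ_comp_proj]

end Projections

variable {Λ} {A : ∀ n, Subgroup (Λ.G n)} [hA : ∀ n, (A n).Normal]

/-! ### Consequences of the conditions at finite levels -/

section FiniteLevel

theorem ConditionsAt.ker_le {n : ℕ} (h : Λ.ConditionsAt A n) : (Λ.ρ n).ker ≤ A (n + 1) :=
  h.melnikov_eq ▸ Subgroup.map_subtype_le _

theorem ConditionsAt.P_le_A {n : ℕ} (h : Λ.ConditionsAt A n) : Λ.P A (n + 1) ≤ A (n + 1) :=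
  h.P_le.trans h.ker_le

theorem ConditionsAt.eq_of_le_sup_ker {n : ℕ} (h : Λ.ConditionsAt A n)
    {B : Subgroup (Λ.G (n + 1))} [B.Normal] (hB : B ≤ A (n + 1))
    (hA : A (n + 1) ≤ B ⊔ (Λ.ρ n).ker) : B = A (n + 1) :=
  eq_of_le_sup_melnikov hB (by rwa [h.melnikov_eq])

/-- The intersection `H ⊓ A (n + 1)` covers `A (n + 1)` modulo `ker (ρ n) = M(A (n + 1))`, so the
Frattini-type property applies. -/
theorem ConditionsAt.le_of_P_le_map {n : ℕ} (h : Λ.ConditionsAt A n)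
    {H : Subgroup (Λ.G (n + 1))} [H.Normal] (hH : Λ.P A n ≤ H.map (Λ.ρ n)) : A (n + 1) ≤ H := by
  have : H ⊓ A (n + 1) = A (n + 1) := by
    refine h.eq_of_le_sup_ker inf_le_right fun x hx => ?_
    obtain ⟨y, hy, hxy⟩ := hH (Subgroup.mem_map_of_mem _ hx)
    have hk : y⁻¹ * x ∈ (Λ.ρ n).ker := by
      rw [MonoidHom.mem_ker, map_mul, map_inv, hxy, inv_mul_cancel]
    have hyA : y ∈ A (n + 1) := by
      have := (A (n + 1)).mul_mem hx ((A (n + 1)).inv_mem (h.ker_le hk))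
      simpa using this
    have := Subgroup.mul_mem_sup (Subgroup.mem_inf.2 ⟨hy, hyA⟩) hk
    rwa [mul_inv_cancel_left] at this
  exact inf_eq_right.1 this

/-- `A (n + 1)` is perfect, because `P n` is perfect and the kernel is `M(A (n + 1))`. If it fixed
all factors it would lie in `P C(P)`; as `P` is inside the kernel, the same property would give `A =
C(P)`, against the strict inclusion. -/
theorem ConditionsAt.not_le_factorKernel {n : ℕ} (h : Λ.ConditionsAt A n)
    (h' : Λ.ConditionsAt A (n + 1)) : ¬ A (n + 1) ≤ factorKernel (Λ.P A (n + 1)) := by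
  intro hK
  obtain ⟨d, hd⟩ := exists_derivedSubgroup_factorKernel_le h'.product h'.subprimitive.2
  have := derivedSubgroup_normal (A (n + 1)) d
  have hD : derivedSubgroup (A (n + 1)) d = A (n + 1) := by
    refine h.eq_of_le_sup_ker (derivedSubgroup_antitone _ (Nat.zero_le d)) ?_
    rw [← Subgroup.comap_map_eq, derivedSubgroup_map, ← Subgroup.map_le_iff_le_comap]
    exact (derivedSubgroup_eq_of_perfect h.product.commutator_eq d).ge
  refine h'.centralizer_lt.ne (h.eq_of_le_sup_ker h'.centralizer_lt.le ?_)
  rw [sup_comm]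
  exact hD.ge.trans ((derivedSubgroup_mono hK d).trans (hd.trans (sup_le_sup_right h.P_le _)))

theorem ConditionsAt.P_ne_bot {n : ℕ} (h : Λ.ConditionsAt A n) : Λ.P A n ≠ ⊥ := by
  intro hP
  have := h.centralizer_lt
  rw [hP] at this
  refine absurd (le_top : A n ≤ ⊤) (not_le_of_gt (lt_of_le_of_lt ?_ this))
  intro x _
  rw [Subgroup.mem_centralizer_iff]
  intro y hy
  rw [SetLike.mem_coe, Subgroup.mem_bot] at hy
  rw [hy, one_mul, mul_one]

theorem ConditionsAt.nonempty_factor {n : ℕ} (h : Λ.ConditionsAt A n) :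
    Nonempty (SimpleFactor (Λ.P A n)) := by
  by_contra hne
  rw [not_nonempty_iff] at hne
  refine h.P_ne_bot (le_bot_iff.1 ?_)
  have := h.product.le_iSup_factors
  rwa [iSup_of_empty] at this

end FiniteLevel

/-! ### Normal subgroups of the limit -/

variable {n₀ : ℕ}

theorem A_le_map_proj (hΛ : ∀ n ≥ n₀, Λ.ConditionsAt A n)
    {N : Subgroup Λ.limit} [N.Normal] {n : ℕ} (hn : n₀ ≤ n)
    (h : Λ.P A n ≤ N.map (Λ.proj n)) : ∀ m > n, A m ≤ N.map (Λ.proj m) := by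
  have hstep : ∀ m ≥ n, Λ.P A m ≤ N.map (Λ.proj m) → A (m + 1) ≤ N.map (Λ.proj (m + 1)) := by
    intro m hm hP
    have : (N.map (Λ.proj (m + 1))).Normal := Subgroup.Normal.map ‹_› _ (Λ.proj_surjective _)
    exact (hΛ m (hn.trans hm)).le_of_P_le_map (by rwa [map_proj_map_ρ])
  have hP : ∀ m ≥ n, Λ.P A m ≤ N.map (Λ.proj m) := by
    intro m hm
    induction m, hm using Nat.le_induction with
    | base => exact h
    | succ m hm ih => exact (hΛ m (hn.trans hm)).P_le_A.trans (hstep m hm ih)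
  intro m hm
  obtain ⟨m, rfl⟩ : ∃ k, m = k + 1 := ⟨m - 1, by omega⟩
  exact hstep m (by omega) (hP m (by omega))

/-- Everything inside `A (n + 2)` dies in `G n`, since `ρ` sends it into `P (n + 1) ≤ ker (ρ n)`.
This is used twice: on a derived term of the image of `N`, to get solubility, and then on the image
itself, once solubility has forced it to centralise `P`. -/
theorem map_proj_eq_bot (hΛ : ∀ n ≥ n₀, Λ.ConditionsAt A n)
    {N : Subgroup Λ.limit} [N.Normal]
    (h : ∀ n ≥ n₀, ¬ Λ.P A n ≤ N.map (Λ.proj n)) : ∀ n ≥ n₀, N.map (Λ.proj n) = ⊥ := by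
  have hnorm : ∀ n, (N.map (Λ.proj n)).Normal := fun n =>
    Subgroup.Normal.map ‹_› _ (Λ.proj_surjective _)
  have hdown : ∀ n ≥ n₀, ∀ X : Subgroup (Λ.G (n + 2)), X ≤ A (n + 2) →
      (X.map (Λ.ρ (n + 1))).map (Λ.ρ n) = ⊥ := by
    intro n hn X hX
    rw [Subgroup.map_eq_bot_iff]
    exact (Subgroup.map_mono hX).trans (hΛ n hn).P_le
  have hsol : ∀ n ≥ n₀, ∃ d, derivedSubgroup (N.map (Λ.proj n)) d = ⊥ := by
    intro n hn
    have h2 := hΛ (n + 2) (by omega)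
    obtain ⟨d, hd⟩ := exists_derivedSubgroup_factorKernel_le h2.product h2.subprimitive.2
    have hK := (SubprimitiveFactors.le_or_le_factorKernel h2.product h2.subprimitive
      (N.map (Λ.proj (n + 2)))).resolve_left (h _ (by omega))
    refine ⟨d, ?_⟩
    rw [← map_proj_map_ρ, ← map_proj_map_ρ, ← derivedSubgroup_map, ← derivedSubgroup_map]
    exact hdown n hn _ ((derivedSubgroup_mono hK d).trans
      (hd.trans (sup_le (hΛ (n + 1) (by omega)).P_le_A h2.centralizer_lt.le)))
  have hcent : ∀ n ≥ n₀, N.map (Λ.proj n) ≤ A n := by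
    intro n hn
    refine le_trans (fun g hg => ?_) (hΛ n hn).centralizer_lt.le
    refine (hΛ n hn).product.mem_centralizer fun F => ?_
    refine (F.le_or_commute fun x _ y hy => (hnorm n).conj_mem y hy x).resolve_left ?_ g hg
    intro hF
    obtain ⟨d, hd⟩ := hsol n hn
    apply F.2.2.2.ne_bot
    rw [← le_bot_iff, ← hd, ← derivedSubgroup_eq_of_perfect F.2.2.2.commutator_eq d]
    exact derivedSubgroup_mono hF d
  intro n hn
  rw [← map_proj_map_ρ, ← map_proj_map_ρ]
  exact hdown n hn _ (hcent (n + 2) (by omega))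

theorem exists_A_le_map_proj (hΛ : ∀ n ≥ n₀, Λ.ConditionsAt A n)
    {N : Subgroup Λ.limit} [N.Normal] (hN : N ≠ ⊥) :
    ∃ n ≥ n₀, ∀ m > n, A m ≤ N.map (Λ.proj m) := by
  by_cases h : ∃ n ≥ n₀, Λ.P A n ≤ N.map (Λ.proj n)
  · obtain ⟨n, hn, h⟩ := h
    exact ⟨n, hn, A_le_map_proj hΛ hn h⟩
  · push Not at h
    exfalso
    refine hN (le_bot_iff.1 fun x hx => ?_)
    refine Λ.mem_of_forall_proj_mem (k := n₀) isClosed_singleton fun n hn => ?_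
    rw [Subgroup.map_bot, ← map_proj_eq_bot hΛ h n hn]
    exact Subgroup.mem_map_of_mem _ hx

/-- From some level on, the image of `N` contains each `ker (ρ m) ≤ A (m + 1)`, so membership in the
image lifts level by level; closedness then gives membership in `N`. -/
theorem exists_ker_proj_le_of_normal (hΛ : ∀ n ≥ n₀, Λ.ConditionsAt A n)
    {N : Subgroup Λ.limit} [N.Normal] (hN : N ≠ ⊥)
    (hcl : IsClosed (N : Set Λ.limit)) : ∃ n, (Λ.proj n).ker ≤ N := by
  obtain ⟨n, hn, h⟩ := exists_A_le_map_proj hΛ hN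
  refine ⟨n, fun x hx => Λ.mem_of_forall_proj_mem hcl (k := n) fun m hm => ?_⟩
  induction m, hm using Nat.le_induction with
  | base =>
    rw [MonoidHom.mem_ker] at hx
    rw [hx]
    exact Subgroup.one_mem _
  | succ m hm ih =>
    obtain ⟨y, hy, hxy⟩ := ih
    have hk : Λ.proj (m + 1) (x * y⁻¹) ∈ (Λ.ρ m).ker := by
      rw [MonoidHom.mem_ker, ρ_proj, map_mul, map_inv, hxy, mul_inv_cancel]
    have := Subgroup.mul_mem _ (h (m + 1) (by omega) ((hΛ m (by omega)).ker_le hk))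
      (Subgroup.mem_map_of_mem (Λ.proj (m + 1)) hy)
    rwa [← map_mul, inv_mul_cancel_right] at this

theorem ker_proj_ne_bot (hΛ : ∀ n ≥ n₀, Λ.ConditionsAt A n)
    (n : ℕ) : (Λ.proj n).ker ≠ ⊥ := by
  intro hbot
  have h1 := hΛ (max n₀ n) (le_max_left _ _)
  have h2 := hΛ (max n₀ n + 1) (by omega)
  refine h2.P_ne_bot (le_bot_iff.1 fun g hg => ?_)
  obtain ⟨x, rfl⟩ := Λ.proj_surjective _ g
  have hx : Λ.proj (max n₀ n) x = Λ.proj (max n₀ n) 1 := by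
    rw [← ρ_proj, map_one]
    exact h1.P_le hg
  have : x ∈ (Λ.proj n).ker := by
    rw [MonoidHom.mem_ker, Λ.proj_eq_of_le (le_max_right n₀ n) hx, map_one]
  rw [hbot, Subgroup.mem_bot] at this
  rw [this, map_one]
  exact Subgroup.one_mem _

theorem infinite_limit (hΛ : ∀ n ≥ n₀, Λ.ConditionsAt A n) :
    Infinite Λ.limit := by
  by_contra hfin
  rw [not_infinite_iff_finite] at hfin
  obtain ⟨m, hm⟩ := Λ.exists_ker_proj_le (U := ⊥) (isOpen_discrete _)
  exact ker_proj_ne_bot hΛ m (le_bot_iff.1 (hm m le_rfl))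

end InverseSystem

/-! ### Intersections of conjugates -/

section Conjugates

variable {G : Type*} [Group G]

/-- The conjugate `g N g⁻¹`. -/
abbrev conjSubgroup (N : Subgroup G) (g : G) : Subgroup G :=
  N.comap (MulAut.conj g⁻¹).toMonoidHom

theorem mem_conjSubgroup {N : Subgroup G} {g x : G} :
    x ∈ conjSubgroup N g ↔ g⁻¹ * x * g ∈ N := by
  simp [conjSubgroup]

/-- The intersection of the conjugates of `N` by the elements of `S`. -/
def conjInf (N : Subgroup G) (S : Set G) : Subgroup G := ⨅ s ∈ S, conjSubgroup N s

theorem mem_conjInf {N : Subgroup G} {S : Set G} {x : G} :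
    x ∈ conjInf N S ↔ ∀ s ∈ S, s⁻¹ * x * s ∈ N := by
  simp [conjInf, Subgroup.mem_iInf]

theorem conjInf_singleton_one (N : Subgroup G) : conjInf N {1} = N := by
  ext x
  simp [mem_conjInf]

theorem conjInf_inf (N : Subgroup G) (S T : Set G) :
    conjInf N S ⊓ conjInf N T = conjInf N (S ∪ T) := by
  ext x
  simp only [Subgroup.mem_inf, mem_conjInf, Set.mem_union]
  exact ⟨fun h s hs => hs.elim (h.1 s) (h.2 s), fun h => ⟨fun s hs => h s (.inl hs),
    fun s hs => h s (.inr hs)⟩⟩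

theorem conjSubgroup_conjInf (N : Subgroup G) (S : Set G) (g : G) :
    conjSubgroup (conjInf N S) g = conjInf N ((g * ·) '' S) := by
  ext x
  simp only [mem_conjSubgroup, mem_conjInf, Set.forall_mem_image, mul_inv_rev, mul_assoc]

/-- Since `V` normalises `N`, the intersection depends only on the image of `S` in the finite set `G
⧸ V`. -/
theorem finite_range_conjInf {N V : Subgroup G} [V.FiniteIndex]
    (hN : ∀ v ∈ V, ∀ x ∈ N, v * x * v⁻¹ ∈ N) : (Set.range (conjInf N)).Finite := by
  have : Finite (G ⧸ V) := inferInstance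
  refine (Set.finite_range fun Q : Set (G ⧸ V) =>
    conjInf N ((QuotientGroup.mk : G → G ⧸ V) ⁻¹' Q)).subset ?_
  rintro _ ⟨S, rfl⟩
  refine ⟨QuotientGroup.mk '' S, ?_⟩
  ext x
  simp only [mem_conjInf]
  refine ⟨fun h s hs => h s ⟨s, hs, rfl⟩, ?_⟩
  rintro h t ⟨s, hs, hst⟩
  rw [QuotientGroup.eq] at hst
  have := hN _ (V.inv_mem hst) _ (h s hs)
  simpa [mul_assoc] using this

/-- Among the intersections of conjugates of `N` there is a nontrivial one, contained in `N`, whose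
distinct conjugates intersect trivially. -/
theorem exists_conjInf_disjoint {N V : Subgroup G} [V.FiniteIndex]
    (hN : ∀ v ∈ V, ∀ x ∈ N, v * x * v⁻¹ ∈ N) (hne : N ≠ ⊥) :
    ∃ S : Set G, conjInf N S ≠ ⊥ ∧ conjInf N S ≤ N ∧
      ∀ g h, conjSubgroup (conjInf N S) g = conjSubgroup (conjInf N S) h ∨
        Disjoint (conjSubgroup (conjInf N S) g) (conjSubgroup (conjInf N S) h) := by
  have hfin : {L : Subgroup G | L ≠ ⊥ ∧ L ∈ Set.range (conjInf N)}.Finite :=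
    (finite_range_conjInf hN).subset fun L hL => hL.2
  obtain ⟨I, hI, hmin⟩ := hfin.exists_le_minimal (a := N) ⟨hne, {1}, conjInf_singleton_one N⟩
  obtain ⟨hIne, S, rfl⟩ := hmin.prop
  -- Conjugating back by `g` shows that each conjugate of the minimal intersection is again minimal.
  have hconj : ∀ g T, conjInf N T ≠ ⊥ → conjInf N T ≤ conjSubgroup (conjInf N S) g →
      conjInf N T = conjSubgroup (conjInf N S) g := by
    intro g T hT hle
    refine le_antisymm hle ?_
    have h1 : conjSubgroup (conjInf N T) g⁻¹ ≤ conjInf N S := by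
      intro x hx
      have := hle (mem_conjSubgroup.1 hx)
      rw [mem_conjSubgroup] at this
      simpa [mul_assoc] using this
    have h2 : conjSubgroup (conjInf N T) g⁻¹ ≠ ⊥ := by
      obtain ⟨⟨x, hx⟩, hx1⟩ := Subgroup.ne_bot_iff_exists_ne_one.1 hT
      intro hb
      have : g⁻¹ * x * g ∈ conjSubgroup (conjInf N T) g⁻¹ := by
        rw [mem_conjSubgroup]
        simpa [mul_assoc] using hx
      rw [hb, Subgroup.mem_bot] at this
      refine hx1 (Subtype.ext ?_)
      simpa [mul_assoc] using congrArg (fun y => g * y * g⁻¹) this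
    have h3 := hmin.le_of_le ⟨h2, _, (conjSubgroup_conjInf N T g⁻¹).symm⟩ h1
    intro x hx
    have := h3 (mem_conjSubgroup.1 hx)
    rw [mem_conjSubgroup] at this
    simpa [mul_assoc] using this
  refine ⟨S, hIne, hI, fun g h => ?_⟩
  by_cases hd : conjSubgroup (conjInf N S) g ⊓ conjSubgroup (conjInf N S) h = ⊥
  · exact Or.inr (disjoint_iff.2 hd)
  · left
    -- The intersection of two conjugates is itself an intersection of conjugates of `N`; if
    -- nontrivial, it equals both of them by minimality.
    have hu : conjSubgroup (conjInf N S) g ⊓ conjSubgroup (conjInf N S) h =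
        conjInf N ((g * ·) '' S ∪ (h * ·) '' S) := by
      rw [conjSubgroup_conjInf, conjSubgroup_conjInf, conjInf_inf]
    rw [hu] at hd
    exact (hconj g _ hd (hu ▸ inf_le_left)).symm.trans (hconj h _ hd (hu ▸ inf_le_right))

theorem iSup_conjSubgroup_normal (F : Subgroup G) : (⨆ g, conjSubgroup F g).Normal := by
  rw [← Subgroup.normalizer_eq_top_iff, eq_top_iff]
  intro h _
  rw [Subgroup.mem_normalizer_iff_map_conj_eq, Subgroup.map_iSup]
  refine (Equiv.mulLeft h).iSup_congr fun g => ?_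
  ext x
  rw [mem_conjSubgroup]
  constructor
  · intro hx
    exact ⟨h⁻¹ * x * h, by rw [SetLike.mem_coe, mem_conjSubgroup]; simpa [mul_assoc] using hx,
      by simp [mul_assoc]⟩
  · rintro ⟨y, hy, rfl⟩
    rw [SetLike.mem_coe, mem_conjSubgroup] at hy
    simpa [mul_assoc] using hy

theorem commute_of_disjoint {J L : Subgroup G} (hd : Disjoint J L)
    (hJ : ∀ y ∈ L, ∀ x ∈ J, y * x * y⁻¹ ∈ J) (hL : ∀ x ∈ J, ∀ y ∈ L, x * y * x⁻¹ ∈ L)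
    {x y : G} (hx : x ∈ J) (hy : y ∈ L) : x * y = y * x := by
  rw [← commutatorElement_eq_one_iff_mul_comm]
  refine Subgroup.disjoint_def.1 hd ?_ (L.mul_mem (hL x hx y hy) (L.inv_mem hy))
  have : ⁅x, y⁆ = x * (y * x⁻¹ * y⁻¹) := by simp [commutatorElement_def, mul_assoc]
  rw [this]
  exact J.mul_mem hx (hJ y hy _ (J.inv_mem hx))

end Conjugates

/-! ### Open subgroups of the limit: the hereditary property -/

namespace InverseSystem

variable {Λ : InverseSystem.{u}} {A : ∀ n, Subgroup (Λ.G n)} [hA : ∀ n, (A n).Normal] {n₀ : ℕ}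

theorem exists_ker_proj_le_of_normalized (hΛ : ∀ n ≥ n₀, Λ.ConditionsAt A n)
    {N V : Subgroup Λ.limit} [hV : V.Normal] [V.FiniteIndex]
    (hNV : N ≤ V) (hVN : ∀ v ∈ V, ∀ x ∈ N, v * x * v⁻¹ ∈ N) (hne : N ≠ ⊥)
    (hcl : IsClosed (N : Set Λ.limit)) : ∃ n, (Λ.proj n).ker ≤ N := by
  obtain ⟨S, hI, hIN, hdisj⟩ := exists_conjInf_disjoint hVN hne
  set I := conjInf N S with hIdef
  have hIcl : IsClosed (I : Set Λ.limit) := by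
    have : (I : Set Λ.limit) = ⋂ s ∈ S, (fun x => s⁻¹ * x * s) ⁻¹' (N : Set Λ.limit) := by
      ext x
      simp [hIdef, mem_conjInf]
    rw [this]
    exact isClosed_biInter fun s _ => hcl.preimage (by fun_prop)
  by_cases hnorm : ∀ g, conjSubgroup I g = I
  · have : I.Normal := ⟨fun x hx g => by
      rw [← hnorm g, mem_conjSubgroup]
      simpa [mul_assoc] using hx⟩
    obtain ⟨n, hn⟩ := exists_ker_proj_le_of_normal hΛ hI hIcl
    exact ⟨n, hn.trans hIN⟩
  exfalso
  push Not at hnorm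
  obtain ⟨g₀, hg₀⟩ := hnorm
  have hJV : ∀ g, conjSubgroup I g ≤ V := by
    intro g x hx
    have := hV.conj_mem _ (hNV (hIN (mem_conjSubgroup.1 hx))) g
    simpa [mul_assoc] using this
  have hVJ : ∀ g, ∀ v ∈ V, ∀ x ∈ conjSubgroup I g, v * x * v⁻¹ ∈ conjSubgroup I g := by
    intro g v hv x hx
    rw [mem_conjSubgroup, hIdef, mem_conjInf] at hx ⊢
    intro s hs
    have := hVN _ (hV.conj_mem v hv (s⁻¹ * g⁻¹)) _ (hx s hs)
    simpa [mul_assoc] using this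
  have hMn : (⨆ g, conjSubgroup I g).Normal := iSup_conjSubgroup_normal I
  have hMne : (⨆ g, conjSubgroup I g) ≠ ⊥ := by
    intro hb
    refine hI (le_bot_iff.1 (hb ▸ le_iSup_of_le 1 ?_))
    intro x hx
    rw [mem_conjSubgroup]
    simpa using hx
  obtain ⟨n, hn, hAM⟩ := exists_A_le_map_proj hΛ hMne
  have hm := hΛ (n + 1) (by omega)
  have hAM := hAM (n + 1) (by omega)
  set M := ⨆ g, conjSubgroup I g with hM
  have hMV : M ≤ V := iSup_le hJV
  have hMn' : (M.map (Λ.proj (n + 1))).Normal := hMn.map _ (Λ.proj_surjective _)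
  have hPM : Λ.P A (n + 1) ≤ M.map (Λ.proj (n + 1)) := (hΛ n hn).P_le_A.trans hAM
  have hMJ : ∀ g, ∀ v ∈ M.map (Λ.proj (n + 1)),
      ∀ x ∈ (conjSubgroup I g).map (Λ.proj (n + 1)),
        v * x * v⁻¹ ∈ (conjSubgroup I g).map (Λ.proj (n + 1)) := by
    rintro g _ ⟨v, hv, rfl⟩ _ ⟨x, hx, rfl⟩
    exact ⟨v * x * v⁻¹, hVJ g v (hMV hv) x hx, by simp⟩
  obtain ⟨F⟩ := hm.nonempty_factor
  -- If no conjugate covered `F`, all would centralise it, hence so would their join `M`, whose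
  -- image contains `F`; but `F` is nonabelian.
  have hex : ∃ g, F.1 ≤ (conjSubgroup I g).map (Λ.proj (n + 1)) := by
    by_contra hno
    push Not at hno
    have hc : M.map (Λ.proj (n + 1)) ≤ Subgroup.centralizer (F.1 : Set (Λ.G (n + 1))) := by
      rw [hM, Subgroup.map_iSup]
      refine iSup_le fun g h hh => ?_
      have := (F.le_or_commute fun x hx => hMJ g x (hPM (F.2.1 hx))).resolve_left (hno g) h hh
      rw [Subgroup.mem_centralizer_iff]
      exact fun x hx => (this x hx).symm
    obtain ⟨x, hx, y, hy, hxy⟩ := F.2.2.2.2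
    exact hxy (Subgroup.mem_centralizer_iff.1 (hc (hPM (F.2.1 hy))) x hx)
  obtain ⟨g, hg⟩ := hex
  obtain ⟨k, hk⟩ : ∃ k, conjSubgroup I k ≠ conjSubgroup I g := by
    by_contra hall
    push Not at hall
    apply hg₀
    rw [hall g₀, ← hall 1]
    ext x
    simp
  have hcomm := (hdisj k g).resolve_left hk
  have hfix : ∀ x ∈ (conjSubgroup I k).map (Λ.proj (n + 1)), x • F = F := by
    rintro _ ⟨x, hx, rfl⟩
    refine SimpleFactor.smul_eq_of_commute fun y hy => ?_
    obtain ⟨y, hyJ, rfl⟩ := hg hy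
    rw [← map_mul, ← map_mul, commute_of_disjoint hcomm (fun y hy => hVJ k y (hJV g hy))
      (fun x hx => hVJ g x (hJV k hx)) hx hyJ]
  have hkM : (conjSubgroup I k).map (Λ.proj (n + 1)) ≤ M.map (Λ.proj (n + 1)) :=
    Subgroup.map_mono (le_iSup (fun g => conjSubgroup I g) k)
  -- The `k`-th conjugate centralises `F` and is normalised by `M`, so it fixes the whole `M`-orbit
  -- of `F`; subprimitivity is applied to `M`, which is normal in the whole group although the
  -- conjugate is not.
  have hK : (conjSubgroup I k).map (Λ.proj (n + 1)) ≤ factorKernel (Λ.P A (n + 1)) := by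
    intro x hx
    rw [mem_factorKernel]
    refine hm.subprimitive.1 _ hMn' F x (hkM hx) ?_
    rintro _ ⟨z, rfl⟩
    change x • z.1 • F = z.1 • F
    have := hfix _ (hMJ k z.1⁻¹ (Subgroup.inv_mem _ z.2) x hx)
    rw [inv_inv, mul_smul, mul_smul, inv_smul_eq_iff] at this
    exact this
  -- The kernel of the action is normal, so it contains every conjugate along with the `k`-th, hence
  -- `M` and `A (n + 1)`.
  refine (hΛ n hn).not_le_factorKernel hm (hAM.trans ?_)
  rw [hM, Subgroup.map_iSup]
  refine iSup_le fun a => ?_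
  rintro _ ⟨x, hx, rfl⟩
  have h1 : Λ.proj (n + 1) (k * a⁻¹ * x * (k * a⁻¹)⁻¹) ∈ factorKernel (Λ.P A (n + 1)) := by
    refine hK ⟨_, ?_, rfl⟩
    rw [SetLike.mem_coe, mem_conjSubgroup] at hx ⊢
    simpa [mul_assoc] using hx
  have h2 := (inferInstance : (factorKernel (Λ.P A (n + 1))).Normal).conj_mem _ h1
    (Λ.proj (n + 1) (k * a⁻¹)⁻¹)
  rw [← map_mul, ← map_inv, ← map_mul] at h2
  simpa [mul_assoc] using h2

/-- Reduction to `N ⊓ V` with `V` open normal inside `U`. This is nontrivial: otherwise `N`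
centralises `V`, and the nontrivial normal subgroups `V` and `C(V)` both cover `A m` for large `m`,
which would make a simple factor abelian. -/
theorem exists_ker_proj_le_of_isOpen (hΛ : ∀ n ≥ n₀, Λ.ConditionsAt A n)
    {N U : Subgroup Λ.limit} (hU : IsOpen (U : Set Λ.limit)) (hUN : ∀ u ∈ U, ∀ x ∈ N, u * x * u⁻¹ ∈ N) (hne : N ≠ ⊥)
    (hcl : IsClosed (N : Set Λ.limit)) : ∃ n, (Λ.proj n).ker ≤ N := by
  obtain ⟨k, hk⟩ := Λ.exists_ker_proj_le hU
  have hk := hk k le_rfl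
  have hVo := Λ.isOpen_ker_proj k
  have hVne := ker_proj_ne_bot hΛ k
  have hVf : (Λ.proj k).ker.FiniteIndex := inferInstance
  have hVn : (Λ.proj k).ker.Normal := inferInstance
  generalize (Λ.proj k).ker = V at *
  by_cases hd : N ⊓ V = ⊥
  · exfalso
    have hcomm : ∀ x ∈ N, ∀ v ∈ V, x * v = v * x := fun x hx v hv =>
      commute_of_disjoint (disjoint_iff.2 hd) (fun v hv => hUN v (hk hv))
        (fun x _ v hv => hVn.conj_mem v hv x) hx hv
    have hCne : Subgroup.centralizer (V : Set Λ.limit) ≠ ⊥ := by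
      intro hb
      refine hne (le_bot_iff.1 (hb ▸ fun x hx => ?_))
      rw [Subgroup.mem_centralizer_iff]
      exact fun v hv => (hcomm x hx v hv).symm
    obtain ⟨m, hm, hC⟩ := exists_A_le_map_proj hΛ hCne
    obtain ⟨l, -, hV⟩ := exists_A_le_map_proj hΛ hVne
    obtain ⟨F⟩ := (hΛ (max m l + 1) (by omega)).nonempty_factor
    have hFA := F.2.1.trans (hΛ (max m l) (by omega)).P_le_A
    obtain ⟨x, hx, y, hy, hxy⟩ := F.2.2.2.2
    obtain ⟨x, hxC, rfl⟩ := hC _ (by omega) (hFA hx)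
    obtain ⟨y, hyV, rfl⟩ := hV _ (by omega) (hFA hy)
    apply hxy
    rw [← map_mul, ← map_mul, Subgroup.mem_centralizer_iff.1 hxC y hyV]
  · obtain ⟨n, hn⟩ := exists_ker_proj_le_of_normalized hΛ (N := N ⊓ V) inf_le_right
      (fun v hv x hx => ⟨hUN v (hk hv) x hx.1, hVn.conj_mem x hx.2 v⟩) hd
      (hcl.inter (Subgroup.isClosed_of_isOpen V hVo))
    exact ⟨n, hn.trans inf_le_left⟩

theorem justInfinite_of_isOpen (hΛ : ∀ n ≥ n₀, Λ.ConditionsAt A n) {U : Subgroup Λ.limit}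
    (hU : IsOpen (U : Set Λ.limit)) : JustInfinite U := by
  constructor
  · by_contra hfin
    rw [not_infinite_iff_finite] at hfin
    have := infinite_limit hΛ
    obtain ⟨k, hk⟩ := Λ.exists_ker_proj_le hU
    have : U.FiniteIndex := Subgroup.finiteIndex_of_le (hk k le_rfl)
    have h := U.card_mul_index
    rw [Nat.card_eq_zero_of_infinite (α := Λ.limit), mul_eq_zero] at h
    exact h.elim Nat.card_pos.ne' this.index_ne_zero
  · intro N hN hcl hne
    have hU' : ∀ u ∈ U, ∀ x ∈ N.map U.subtype, u * x * u⁻¹ ∈ N.map U.subtype := by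
      rintro u hu _ ⟨x, hx, rfl⟩
      exact ⟨⟨u, hu⟩ * x * ⟨u, hu⟩⁻¹, hN.conj_mem x hx _, rfl⟩
    have hne' : N.map U.subtype ≠ ⊥ := by
      rwa [Ne, Subgroup.map_eq_bot_iff_of_injective _ U.subtype_injective]
    obtain ⟨n, hn⟩ := exists_ker_proj_le_of_isOpen hΛ hU hU' hne'
      ((Subgroup.isClosed_of_isOpen U hU).isClosedMap_subtype_val _ hcl)
    have : (N.map U.subtype).FiniteIndex := Subgroup.finiteIndex_of_le hn
    have h : (N.map U.subtype).subgroupOf U = N :=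
      Subgroup.comap_map_eq_self_of_injective U.subtype_injective N
    rw [← h]
    infer_instance

theorem hereditarilyJustInfinite (hΛ : ∀ n ≥ n₀, Λ.ConditionsAt A n) :
    HereditarilyJustInfinite Λ.limit := by
  refine ⟨⟨infinite_limit hΛ, fun N hN hcl hne => ?_⟩, fun U hU => justInfinite_of_isOpen hΛ hU⟩
  obtain ⟨n, hn⟩ := exists_ker_proj_le_of_normal hΛ hne hcl
  exact Subgroup.finiteIndex_of_le hn

theorem not_virtuallyProsoluble (hΛ : ∀ n ≥ n₀, Λ.ConditionsAt A n) :
    ¬ VirtuallyProsoluble Λ.limit := by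
  rintro ⟨U, hU, hsol⟩
  obtain ⟨k, hk⟩ := Λ.exists_ker_proj_le hU
  obtain ⟨n, hn, hV⟩ := exists_A_le_map_proj hΛ (ker_proj_ne_bot hΛ k)
  obtain ⟨F⟩ := (hΛ (n + 1) (by omega)).nonempty_factor
  have hFU : F.1 ≤ U.map (Λ.proj (n + 1)) :=
    F.2.1.trans ((hΛ n hn).P_le_A.trans
      ((hV (n + 1) (by omega)).trans (Subgroup.map_mono (hk k le_rfl))))
  have hs := hsol ((Λ.proj (n + 1)).ker.subgroupOf U)
    ((Λ.isOpen_ker_proj (n + 1)).preimage continuous_subtype_val)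
  obtain ⟨d, hd⟩ := derivedSubgroup_le_of_isSolvable (K := U) (L := (Λ.proj (n + 1)).ker)
  refine F.2.2.2.ne_bot (le_bot_iff.1 ?_)
  rw [← derivedSubgroup_eq_of_perfect F.2.2.2.commutator_eq d]
  refine (derivedSubgroup_mono hFU d).trans ?_
  rw [← derivedSubgroup_map, le_bot_iff, Subgroup.map_eq_bot_iff]
  exact hd

end InverseSystem

/-! ### Computing the Mel'nikov subgroup -/

section Melnikov

variable {G : Type*} [Group G]

theorem commutator_top_le_of_sup_eq_top {L W T : Subgroup G} [L.Normal] [W.Normal] [T.Normal]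
    (hW : W ⊔ L = ⊤) (hT : T ⊔ L = ⊤) (h : W ⊓ T ≤ L) : ⁅(⊤ : Subgroup G), (⊤ : Subgroup G)⁆ ≤ L := by
  have key : ∀ X : Subgroup G, X ⊔ L = ⊤ → X.map (QuotientGroup.mk' L) = ⊤ := by
    intro X hX
    rw [eq_top_iff, ← Subgroup.map_top_of_surjective _ (QuotientGroup.mk'_surjective L),
      Subgroup.map_le_iff_le_comap, Subgroup.comap_map_eq, QuotientGroup.ker_mk', hX]
  have h1 : (⁅W, T⁆ : Subgroup G).map (QuotientGroup.mk' L) = ⊥ := by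
    rw [Subgroup.map_eq_bot_iff, QuotientGroup.ker_mk']
    exact (Subgroup.commutator_le_inf W T).trans h
  rw [Subgroup.map_commutator, key W hW, key T hT] at h1
  rw [← QuotientGroup.ker_mk' L, ← Subgroup.map_eq_bot_iff, Subgroup.map_commutator,
    key ⊤ (top_sup_eq L), h1]

variable [TopologicalSpace G] [DiscreteTopology G]

theorem maximal_comap_equiv {L : Subgroup G}
    (hL : Maximal (fun L : Subgroup G => L.Normal ∧ IsOpen (L : Set G) ∧ L ≠ ⊤) L)
    (φ : MulAut G) :
    Maximal (fun L : Subgroup G => L.Normal ∧ IsOpen (L : Set G) ∧ L ≠ ⊤)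
      (L.comap φ.toMonoidHom) := by
  have hne : ∀ (M : Subgroup G) (φ : MulAut G), M ≠ ⊤ → M.comap φ.toMonoidHom ≠ ⊤ := by
    intro M φ hM h
    refine hM (eq_top_iff.2 fun x _ => ?_)
    have : φ.symm x ∈ M.comap φ.toMonoidHom := h ▸ Subgroup.mem_top _
    simpa using this
  refine ⟨⟨hL.prop.1.comap _, isOpen_discrete _, hne _ _ hL.prop.2.2⟩, fun M hM hLM x hx => ?_⟩
  have h1 : L ≤ M.comap φ.symm.toMonoidHom := fun y hy => hLM (by
    change φ (φ.symm y) ∈ L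
    rwa [MulEquiv.apply_symm_apply])
  have h2 := hL.le_of_ge ⟨hM.1.comap _, isOpen_discrete _, hne _ φ.symm hM.2.2⟩ h1
  refine h2 ?_
  change φ.symm (φ x) ∈ M
  rwa [MulEquiv.symm_apply_apply]

theorem apply_mem_melnikov (φ : MulAut G) {x : G} (hx : x ∈ melnikov G) : φ x ∈ melnikov G := by
  rw [melnikov, Subgroup.mem_sInf] at hx ⊢
  exact fun L hL => hx _ (maximal_comap_equiv hL φ)

theorem melnikov_ne_top [Finite G] [Nontrivial G] : melnikov G ≠ ⊤ := by
  intro h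
  have hmem : (⊥ : Subgroup G) ∈ {L : Subgroup G | L.Normal ∧ IsOpen (L : Set G) ∧ L ≠ ⊤} :=
    ⟨inferInstance, isOpen_discrete _, bot_ne_top⟩
  obtain ⟨M, -, hM⟩ := (Set.toFinite _).exists_le_maximal hmem
  exact hM.prop.2.2 (top_le_iff.1 (h ▸ sInf_le hM))

end Melnikov

section

variable {G : Type*} [Group G] [Finite G]

/-- If `T < A` are normal subgroups of a finite group `G` such that `A / T` is nonabelian and `T`
contains every normal subgroup of `G` properly contained in `A`, then `M(A) = T`. -/
theorem map_melnikov_eq {A T : Subgroup G} [hA : A.Normal] [hT : T.Normal]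
    [TopologicalSpace A] [DiscreteTopology A] (hTA : T < A) (hcomm : ¬ ⁅A, A⁆ ≤ T)
    (huniq : ∀ Y : Subgroup G, Y.Normal → Y ≤ A → Y = A ∨ Y ≤ T) :
    (melnikov A).map A.subtype = T := by
  have hperf : (⁅(⊤ : Subgroup A), (⊤ : Subgroup A)⁆ : Subgroup A) = ⊤ := by
    have h := (huniq ⁅A, A⁆ inferInstance (commutator_self_le A)).resolve_right hcomm
    apply Subgroup.map_injective A.subtype_injective
    rwa [Subgroup.map_commutator, ← MonoidHom.range_eq_map, Subgroup.range_subtype]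
  apply le_antisymm
  -- `M(A)` is invariant under all automorphisms of `A`, so it is normal in `G`; being proper, it
  -- lies in `T`.
  · have hn : ((melnikov A).map A.subtype).Normal := by
      refine ⟨?_⟩
      rintro _ ⟨x, hx, rfl⟩ g
      exact ⟨MulAut.conjNormal g x, apply_mem_melnikov _ hx, MulAut.conjNormal_apply _ _⟩
    refine (huniq _ hn (Subgroup.map_subtype_le _)).resolve_left fun h => ?_
    have : Nontrivial A := (Subgroup.nontrivial_iff_ne_bot A).2 (ne_bot_of_gt hTA)
    apply melnikov_ne_top (G := A)
    apply Subgroup.map_injective A.subtype_injective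
    rw [h, ← MonoidHom.range_eq_map, Subgroup.range_subtype]
  · suffices h : T.subgroupOf A ≤ melnikov A from fun x hx =>
      ⟨⟨x, hTA.le hx⟩, h hx, rfl⟩
    refine le_sInf fun L hL => ?_
    rw [Set.mem_ofPred_eq] at hL
    by_contra hTL
    -- For a maximal `L` not containing `T`, no finite intersection of `G`-conjugates of `L` lies in
    -- `T`. The intersection of all of them is normal in `G`, so it would have to be `A`, which is
    -- absurd as `L` is proper.
    have hind : ∀ s : Finset G, ¬ (⨅ g ∈ s, L.comap (MulAut.conjNormal g).toMonoidHom) ≤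
        T.subgroupOf A := by
      classical
      intro s
      induction s using Finset.induction_on with
      | empty =>
        intro h
        apply hTA.not_ge
        simpa [Subgroup.subgroupOf_eq_top] using h
      | insert g s _ ih =>
        rw [Finset.iInf_insert]
        set W := ⨅ g ∈ s, L.comap (MulAut.conjNormal g).toMonoidHom with hW
        have hLg := maximal_comap_equiv hL (MulAut.conjNormal g)
        have hTg : ¬ T.subgroupOf A ≤ L.comap (MulAut.conjNormal g).toMonoidHom := by
          intro h
          refine hTL fun x hx => ?_
          have := h (x := MulAut.conjNormal g⁻¹ x) (by
            rw [Subgroup.mem_subgroupOf, MulAut.conjNormal_apply]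
            exact hT.conj_mem _ hx _)
          rw [Subgroup.mem_comap] at this
          change MulAut.conjNormal g (MulAut.conjNormal g⁻¹ x) ∈ L at this
          rwa [← MulAut.mul_apply, ← map_mul, mul_inv_cancel, map_one] at this
        have hWn : W.Normal := Subgroup.normal_iInf_normal fun g =>
          Subgroup.normal_iInf_normal fun _ => hL.prop.1.comap _
        generalize L.comap (MulAut.conjNormal g).toMonoidHom = Lg at *
        have hLgn := hLg.prop.1
        have hmax : ∀ X : Subgroup A, X.Normal → ¬ X ≤ Lg → X ⊔ Lg = ⊤ := by
          intro X hX hXL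
          by_contra hne
          exact hXL (le_sup_left.trans
            (hLg.le_of_ge ⟨Subgroup.sup_normal _ _, isOpen_discrete _, hne⟩ le_sup_right))
        intro hle
        have hWL : ¬ W ≤ Lg := fun h => ih ((le_inf h le_rfl).trans hle)
        -- Otherwise `W ⊓ T` and `Lg` generate `A`; writing `w = t * l` puts `l` in `W ⊓ Lg ≤ T`, so
        -- `W ≤ T`, against the induction hypothesis. Once this holds, `W` and `T` both cover `A /
        -- Lg` and commute there, against perfectness.
        have hWT : W ⊓ T.subgroupOf A ≤ Lg := by
          by_contra h
          refine ih fun w hw => ?_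
          have hwt : w ∈ (W ⊓ T.subgroupOf A) ⊔ Lg := by
            rw [hmax _ inferInstance h]; exact Subgroup.mem_top _
          rw [Subgroup.mem_sup_of_normal_right] at hwt
          obtain ⟨t, ht, l, hl, rfl⟩ := hwt
          refine Subgroup.mul_mem _ ht.2 (hle ⟨hl, ?_⟩)
          have := W.mul_mem (W.inv_mem ht.1) hw
          rwa [inv_mul_cancel_left] at this
        have := commutator_top_le_of_sup_eq_top (hmax W hWn hWL)
          (hmax (T.subgroupOf A) inferInstance hTg) hWT
        rw [hperf, top_le_iff] at this
        exact hLg.prop.2.2 this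
    have := Fintype.ofFinite G
    have hu := hind Finset.univ
    simp only [Finset.mem_univ, iInf_pos] at hu
    have hn : ((⨅ g, L.comap (MulAut.conjNormal g).toMonoidHom).map A.subtype).Normal := by
      refine ⟨?_⟩
      rintro _ ⟨x, hx, rfl⟩ h
      refine ⟨MulAut.conjNormal h x, ?_, MulAut.conjNormal_apply _ _⟩
      rw [SetLike.mem_coe, Subgroup.mem_iInf] at hx ⊢
      intro g
      have := hx (g * h)
      rw [map_mul] at this
      exact this
    rcases huniq _ hn (Subgroup.map_subtype_le _) with h | h
    · apply hL.prop.2.2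
      rw [eq_top_iff]
      intro x _
      have hx : x.1 ∈ (⨅ g, L.comap (MulAut.conjNormal g).toMonoidHom).map A.subtype :=
        h.ge x.2
      obtain ⟨y, hy, hxy⟩ := hx
      rw [SetLike.mem_coe, Subgroup.mem_iInf] at hy
      have := hy 1
      rw [map_one] at this
      rw [← Subtype.ext hxy]
      exact this
    · exact hu (Subgroup.map_le_iff_le_comap.1 h)

end

/-! ### Nonabelian minimal normal subgroups -/

section MinimalNormal

variable {G : Type*} [Group G]

theorem centralizer_le_normalizer_of_le {F N : Subgroup G} (h : N ≤ F) :
    Subgroup.centralizer (F : Set G) ≤ Subgroup.normalizer (N : Set G) := by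
  intro c hc
  rw [Subgroup.mem_normalizer_iff_map_conj_eq]
  have hcx : ∀ x ∈ N, c * x * c⁻¹ = x := fun x hx => by
    rw [← Subgroup.mem_centralizer_iff.1 hc x (h hx), mul_inv_cancel_right]
  ext x
  constructor
  · rintro ⟨y, hy, rfl⟩
    change c * y * c⁻¹ ∈ N
    rwa [hcx y hy]
  · exact fun hx => ⟨x, hx, hcx x hx⟩

/-- A nonabelian minimal normal subgroup of a finite group is a direct product of nonabelian simple
groups. -/
theorem isProductOfNonabelianSimple_of_minimal {G : Type u} [Group G] [Finite G]
    {P : Subgroup G} [hP : P.Normal]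
    (hmin : ∀ Y : Subgroup G, Y.Normal → Y ≤ P → Y = P ∨ Y = ⊥) (hcomm : ¬ ⁅P, P⁆ = ⊥) :
    IsProductOfNonabelianSimple P := by
  have hPne : P ≠ ⊥ := by
    rintro rfl
    exact hcomm (le_bot_iff.1 (commutator_self_le _))
  -- The simple factors will be the `G`-conjugates of a minimal normal subgroup `F` of `P`.
  obtain ⟨F, hFP, hF⟩ := (Set.toFinite
    {F : Subgroup G | F ≠ ⊥ ∧ F ≤ P ∧ P ≤ Subgroup.normalizer (F : Set G)}).exists_le_minimal
    (a := P) ⟨hPne, le_rfl, Subgroup.le_normalizer⟩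
  have hconj : ∀ (E : Subgroup G) (g : G), E ≠ ⊥ ∧ E ≤ P ∧ P ≤ Subgroup.normalizer (E : Set G) →
      conjSubgroup E g ≠ ⊥ ∧ conjSubgroup E g ≤ P ∧
        P ≤ Subgroup.normalizer (conjSubgroup E g : Set G) := by
    rintro E g ⟨h1, h2, h3⟩
    refine ⟨?_, ?_, ?_⟩
    · obtain ⟨⟨x, hx⟩, hx1⟩ := Subgroup.ne_bot_iff_exists_ne_one.1 h1
      intro hb
      have : g * x * g⁻¹ ∈ conjSubgroup E g := by
        rw [mem_conjSubgroup]
        simpa [mul_assoc] using hx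
      rw [hb, Subgroup.mem_bot] at this
      refine hx1 (Subtype.ext ?_)
      simpa [mul_assoc] using congrArg (fun y => g⁻¹ * y * g) this
    · intro x hx
      have := hP.conj_mem _ (h2 (mem_conjSubgroup.1 hx)) g
      simpa [mul_assoc] using this
    · rw [Subgroup.le_normalizer_iff] at h3 ⊢
      intro p hp x hx
      rw [mem_conjSubgroup] at hx ⊢
      have := h3 _ (hP.conj_mem p hp g⁻¹) _ hx
      simpa [mul_assoc] using this
  have hminconj : ∀ g, Minimal (· ∈ {F : Subgroup G | F ≠ ⊥ ∧ F ≤ P ∧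
      P ≤ Subgroup.normalizer (F : Set G)}) (conjSubgroup F g) := by
    refine fun g => ⟨hconj F g hF.prop, fun E hE hle x hx => ?_⟩
    have := hF.le_of_le (hconj E g⁻¹ hE) fun y hy => by
      have := hle (mem_conjSubgroup.1 hy)
      rw [mem_conjSubgroup] at this
      simpa [mul_assoc] using this
    have := this (mem_conjSubgroup.1 hx)
    rw [mem_conjSubgroup] at this
    simpa [mul_assoc] using this
  set Ω := Set.range (conjSubgroup F) with hΩ
  have hmem : ∀ E ∈ Ω, Minimal (· ∈ {F : Subgroup G | F ≠ ⊥ ∧ F ≤ P ∧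
      P ≤ Subgroup.normalizer (F : Set G)}) E := by
    rintro _ ⟨g, rfl⟩
    exact hminconj g
  have hsup : sSup Ω = P := by
    have h1 : (sSup Ω).Normal := iSup_conjSubgroup_normal F
    refine (hmin _ h1 (sSup_le fun E hE => (hmem E hE).prop.2.1)).resolve_right fun hb => ?_
    exact (hminconj 1).prop.1 (le_bot_iff.1 (hb ▸ le_sSup ⟨1, rfl⟩))
  have hdich : ∀ E ∈ Ω, ∀ X ≤ E, P ≤ Subgroup.normalizer (X : Set G) → X = ⊥ ∨ X = E := by
    intro E hE X hX hPX
    by_cases h : X = ⊥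
    · exact Or.inl h
    · exact Or.inr (le_antisymm hX
        ((hmem E hE).le_of_le ⟨h, hX.trans (hmem E hE).prop.2.1, hPX⟩ hX))
  have hc : ∀ E ∈ Ω, ∀ E' ∈ Ω, E ≠ E' → ∀ x ∈ E, ∀ y ∈ E', x * y = y * x := by
    intro E hE E' hE' hne x hx y hy
    have hpE := (hmem E hE).prop
    have hpE' := (hmem E' hE').prop
    have hn : P ≤ Subgroup.normalizer ((E ⊓ E' : Subgroup G) : Set G) :=
      (le_inf hpE.2.2 hpE'.2.2).trans (Subgroup.inf_normalizer_le_normalizer_inf)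
    have hd : Disjoint E E' := by
      rw [disjoint_iff]
      refine (hdich E hE _ inf_le_left hn).resolve_right fun h => hne ?_
      exact ((hdich E' hE' E (inf_eq_left.1 h) hpE.2.2).resolve_left hpE.1)
    exact commute_of_disjoint hd
      (fun y hy => Subgroup.le_normalizer_iff.1 hpE.2.2 y (hpE'.2.1 hy))
      (fun x hx => Subgroup.le_normalizer_iff.1 hpE'.2.2 x (hpE.2.1 hx)) hx hy
  have hcent : ∀ E ∈ Ω, ∀ E' ∈ Ω, E' ≠ E → E' ≤ Subgroup.centralizer (E : Set G) := by
    intro E hE E' hE' hne y hy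
    rw [Subgroup.mem_centralizer_iff]
    exact fun x hx => hc E hE E' hE' hne.symm x hx y hy
  -- An abelian `E` would be central in `P`; the centre of `P` is normal in `G`, so by minimality
  -- `P` would be abelian.
  have hnonab : ∀ E ∈ Ω, ¬ E ≤ Subgroup.centralizer (E : Set G) := by
    intro E hE hab
    have h1 : P ≤ Subgroup.centralizer (E : Set G) := by
      rw [← hsup]
      refine sSup_le fun E' hE' => ?_
      by_cases h : E' = E
      · exact h ▸ hab
      · exact hcent E hE E' hE' h
    have h2 : E ≤ P ⊓ Subgroup.centralizer (P : Set G) :=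
      le_inf (hmem E hE).prop.2.1 (Subgroup.le_centralizer_iff.1 h1)
    rcases hmin (P ⊓ Subgroup.centralizer (P : Set G)) inferInstance inf_le_left with h | h
    · apply hcomm
      rw [Subgroup.commutator_eq_bot_iff_le_centralizer]
      exact inf_eq_left.1 h
    · exact (hmem E hE).prop.1 (le_bot_iff.1 (h ▸ h2))
  refine ⟨Ω, fun E hE => ⟨?_, ?_⟩, hc, fun E hE => ?_, hsup⟩
  · have : Nontrivial E := (Subgroup.nontrivial_iff_ne_bot E).2 (hmem E hE).prop.1
    refine ⟨fun N hN => ?_⟩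
    -- A normal subgroup of `E` is normalised by all of `P`, because the other conjugates centralise
    -- `E`; minimality of `E` then gives simplicity.
    have hPN : P ≤ Subgroup.normalizer (N.map E.subtype : Set G) := by
      rw [← hsup]
      refine sSup_le fun E' hE' => ?_
      by_cases h : E' = E
      · rw [h, Subgroup.le_normalizer_iff]
        rintro e he _ ⟨x, hx, rfl⟩
        exact ⟨_, hN.conj_mem x hx ⟨e, he⟩, rfl⟩
      · exact (hcent E hE E' hE' h).trans
          (centralizer_le_normalizer_of_le (Subgroup.map_subtype_le N))
    refine (hdich E hE _ (Subgroup.map_subtype_le N) hPN).imp (fun h => ?_) fun h => ?_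
    · rwa [Subgroup.map_eq_bot_iff_of_injective _ E.subtype_injective] at h
    · apply Subgroup.map_injective E.subtype_injective
      rw [h, ← MonoidHom.range_eq_map, Subgroup.range_subtype]
  · by_contra hno
    push Not at hno
    refine hnonab E hE fun x hx => ?_
    rw [Subgroup.mem_centralizer_iff]
    exact fun y hy => hno y hy x hx
  · have h1 : sSup (Ω \ {E}) ≤ Subgroup.centralizer (E : Set G) :=
      sSup_le fun E' hE' => hcent E hE E' hE'.1 hE'.2
    have hn : P ≤ Subgroup.normalizer
        ((E ⊓ Subgroup.centralizer (E : Set G) : Subgroup G) : Set G) := by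
      rw [Subgroup.le_normalizer_iff]
      have hE' := Subgroup.le_normalizer_iff.1 (hmem E hE).prop.2.2
      intro p hp x hx
      rw [Subgroup.mem_inf, Subgroup.mem_centralizer_iff] at hx ⊢
      refine ⟨hE' p hp x hx.1, fun e he => ?_⟩
      have := hx.2 _ (hE' _ (P.inv_mem hp) e he)
      have := congrArg (fun y => p * y * p⁻¹) this
      simpa [mul_assoc] using this
    have h2 : E ⊓ Subgroup.centralizer (E : Set G) = ⊥ :=
      (hdich E hE _ inf_le_left hn).resolve_right fun h => hnonab E hE (inf_eq_left.1 h)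
    rw [disjoint_iff, ← le_bot_iff, ← h2]
    exact inf_le_inf_left E h1

end MinimalNormal

/-! ### Pulling the conditions back along a homomorphism -/

section Transfer

variable {G H : Type u} [Group G] [Group H]

theorem isSolvable_quotient_of_derivedSubgroup_le {K L : Subgroup G} [(L.subgroupOf K).Normal]
    {n : ℕ} (h : derivedSubgroup K n ≤ L) : Group.IsSolvable (K ⧸ L.subgroupOf K) := by
  refine ⟨n, ?_⟩
  rw [← map_derivedSeries_eq (QuotientGroup.mk'_surjective (L.subgroupOf K)),
    Subgroup.map_eq_bot_iff, QuotientGroup.ker_mk']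
  rw [← map_subtype_derivedSeries, Subgroup.map_le_iff_le_comap] at h
  exact h

variable {φ : G →* H} {P : Subgroup G} {Q : Subgroup H}

theorem injOn_of_disjoint_ker (hd : Disjoint P φ.ker) {x y : G} (hx : x ∈ P) (hy : y ∈ P)
    (h : φ x = φ y) : x = y := by
  rw [← mul_inv_eq_one]
  refine Subgroup.disjoint_def.1 hd (P.mul_mem hx (P.inv_mem hy)) ?_
  rw [MonoidHom.mem_ker, map_mul, h, map_inv, mul_inv_cancel]

theorem mem_of_map_mem (hd : Disjoint P φ.ker) {F : Subgroup G} (hF : F ≤ P) {x : G} (hx : x ∈ P)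
    (h : φ x ∈ F.map φ) : x ∈ F := by
  obtain ⟨y, hy, hxy⟩ := h
  exact injOn_of_disjoint_ker hd (hF hy) hx hxy ▸ hy

theorem IsNonabelianSimple.map (hd : Disjoint P φ.ker) {F : Subgroup G} (hF : F ≤ P)
    (h : IsNonabelianSimple F) : IsNonabelianSimple (F.map φ) := by
  obtain ⟨hs, x, hx, y, hy, hxy⟩ := h
  have hne : φ x * φ y ≠ φ y * φ x := by
    rw [← map_mul, ← map_mul]
    exact fun h => hxy (injOn_of_disjoint_ker hd (P.mul_mem (hF hx) (hF hy))
      (P.mul_mem (hF hy) (hF hx)) h)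
  refine ⟨?_, φ x, Subgroup.mem_map_of_mem _ hx, φ y, Subgroup.mem_map_of_mem _ hy, hne⟩
  have : Nontrivial (F.map φ) := by
    refine ⟨⟨⟨φ x, Subgroup.mem_map_of_mem _ hx⟩, 1, fun h => hne ?_⟩⟩
    have : φ x = 1 := congrArg Subtype.val h
    rw [this, one_mul, mul_one]
  exact IsSimpleGroup.isSimpleGroup_of_surjective (φ.subgroupMap F) (φ.subgroupMap_surjective F)

/-- The image of a simple factor under a homomorphism that is injective on `P`. -/
def SimpleFactor.map (φ : G →* H) (hd : Disjoint P φ.ker) (hPQ : P.map φ = Q)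
    (F : SimpleFactor P) : SimpleFactor Q :=
  ⟨F.1.map φ, hPQ ▸ Subgroup.map_mono F.2.1, hPQ ▸ (Subgroup.map_mono F.2.2.1).trans
    (Subgroup.le_normalizer_map φ), F.2.2.2.map hd F.2.1⟩

theorem SimpleFactor.map_injective (hd : Disjoint P φ.ker) (hPQ : P.map φ = Q) :
    Function.Injective (SimpleFactor.map φ hd hPQ) := by
  intro F E h
  refine SimpleFactor.eq_of_le fun x hx => mem_of_map_mem hd E.2.1 (F.2.1 hx) ?_
  have h : F.1.map φ = E.1.map φ := congrArg Subtype.val h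
  exact h ▸ Subgroup.mem_map_of_mem φ hx

theorem SimpleFactor.map_smul [P.Normal] [Q.Normal] (hd : Disjoint P φ.ker) (hPQ : P.map φ = Q)
    (g : G) (F : SimpleFactor P) :
    SimpleFactor.map φ hd hPQ (g • F) = φ g • SimpleFactor.map φ hd hPQ F := by
  refine Subtype.ext ?_
  change (F.1.map (MulAut.conj g).toMonoidHom).map φ =
    (F.1.map φ).map (MulAut.conj (φ g)).toMonoidHom
  rw [Subgroup.map_map, Subgroup.map_map]
  congr 1
  ext x
  simp

/-- Subprimitivity and solubility of the induced outer automorphisms pull back along a surjective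
homomorphism that is injective on `P`. -/
theorem SubprimitiveFactors.of_map [hP : P.Normal] [Q.Normal] (hφ : Function.Surjective φ)
    (hd : Disjoint P φ.ker) (hPQ : P.map φ = Q) (h : SubprimitiveFactors Q) :
    SubprimitiveFactors P := by
  refine ⟨fun K hK F k hk hfix E => ?_, fun F => ?_⟩
  · apply SimpleFactor.map_injective hd hPQ
    rw [SimpleFactor.map_smul]
    refine h.1 (K.map φ) (hK.map φ hφ) (F.map φ hd hPQ) (φ k) (Subgroup.mem_map_of_mem φ hk) ?_ _
    rintro _ ⟨⟨_, l, hl, rfl⟩, rfl⟩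
    change φ k • φ l • F.map φ hd hPQ = φ l • F.map φ hd hPQ
    rw [← SimpleFactor.map_smul, ← SimpleFactor.map_smul]
    exact congrArg _ (hfix (l • F) ⟨⟨l, hl⟩, rfl⟩)
  · have := h.2 (F.map φ hd hPQ)
    obtain ⟨n, hn⟩ := derivedSubgroup_le_of_isSolvable
      (K := Subgroup.normalizer ((F.map φ hd hPQ).1 : Set H))
      (L := (F.map φ hd hPQ).1 ⊔ Subgroup.centralizer ((F.map φ hd hPQ).1 : Set H))
    refine isSolvable_quotient_of_derivedSubgroup_le (n := n) fun x hx => ?_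
    have hxφ : φ x ∈ F.1.map φ ⊔ Subgroup.centralizer (F.1.map φ : Set H) := by
      refine hn (derivedSubgroup_mono (Subgroup.le_normalizer_map φ) n ?_)
      rw [← derivedSubgroup_map]
      exact Subgroup.mem_map_of_mem φ hx
    rw [← SetLike.mem_coe, Subgroup.coe_mul_of_right_le_normalizer_left _ _
        (Subgroup.centralizer_le_normalizer _)] at hxφ
    obtain ⟨_, ⟨f, hf, rfl⟩, c, hc, hfc⟩ := hxφ
    -- The image of `f⁻¹ * x` centralises the image of `F`; conjugation keeps elements of `F` in
    -- `P`, where `φ` is injective, so `f⁻¹ * x` already centralises `F`.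
    have hxc : f⁻¹ * x ∈ Subgroup.centralizer (F.1 : Set G) := by
      rw [Subgroup.mem_centralizer_iff]
      intro y hy
      have hyP := F.2.1 hy
      have key : φ (f⁻¹ * x * y * (f⁻¹ * x)⁻¹) = φ y := by
        have hc' : φ (f⁻¹ * x) = c := by
          rw [map_mul, ← hfc, map_inv]
          exact inv_mul_cancel_left _ _
        rw [map_mul, map_mul, map_inv, hc',
          ← Subgroup.mem_centralizer_iff.1 hc (φ y) (Subgroup.mem_map_of_mem φ hy),
          mul_inv_cancel_right]
      have := injOn_of_disjoint_ker hd (hP.conj_mem y hyP _) hyP key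
      rw [mul_inv_eq_iff_eq_mul] at this
      exact this.symm
    have := Subgroup.mul_mem_sup hf hxc
    rwa [mul_inv_cancel_left] at this

end Transfer

/-! ### Closed normal subgroups of just infinite groups -/

theorem finite_setOf_le_of_finiteIndex {G : Type*} [Group G] (N : Subgroup G) [N.Normal]
    [N.FiniteIndex] : {K : Subgroup G | N ≤ K}.Finite := by
  have : Finite (G ⧸ N) := inferInstance
  refine (Set.finite_range fun Q : Subgroup (G ⧸ N) => Q.comap (QuotientGroup.mk' N)).subset ?_
  intro K hK
  refine ⟨K.map (QuotientGroup.mk' N), ?_⟩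
  change (K.map (QuotientGroup.mk' N)).comap (QuotientGroup.mk' N) = K
  rw [Subgroup.comap_map_eq, QuotientGroup.ker_mk', sup_eq_left]
  exact hK

/-- The closed normal subgroups of `G` that are not contained in `W`. -/
def closedNormalNotLE {G : Type*} [Group G] [TopologicalSpace G] (W : Subgroup G) :
    Set (Subgroup G) :=
  {K | K.Normal ∧ IsClosed (K : Set G) ∧ ¬ K ≤ W}

section JustInfinite

variable {G : Type*} [Group G] [TopologicalSpace G]

theorem JustInfinite.finiteIndex (hG : JustInfinite G) {N : Subgroup G} (hN : N.Normal)
    (hcl : IsClosed (N : Set G)) (hne : N ≠ ⊥) : N.FiniteIndex := hG.2 N hN hcl hne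

theorem JustInfinite.ne_bot_of_finiteIndex (hG : JustInfinite G) {N : Subgroup G}
    [hN : N.FiniteIndex] : N ≠ ⊥ := by
  rintro rfl
  have := hG.1
  apply hN.index_ne_zero
  rw [Subgroup.index_bot, Nat.card_eq_zero_of_infinite]

theorem JustInfinite.iInf_eq_bot_of_strictAnti (hG : JustInfinite G) {f : ℕ → Subgroup G}
    (hf : StrictAnti f) (hn : ∀ n, (f n).Normal) (hcl : ∀ n, IsClosed (f n : Set G)) :
    ⨅ n, f n = ⊥ := by
  by_contra hne
  have hN : (⨅ n, f n).Normal := Subgroup.normal_iInf_normal hn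
  have := hG.finiteIndex hN (by rw [Subgroup.coe_iInf]; exact isClosed_iInter hcl) hne
  exact Set.infinite_of_injective_forall_mem hf.injective
    (fun n => iInf_le f n : ∀ n, f n ∈ {K | ⨅ n, f n ≤ K}) (finite_setOf_le_of_finiteIndex _)

/-- A strictly descending sequence has trivial intersection by just infiniteness, whereas
compactness provides a common point outside `W`. -/
theorem JustInfinite.isWF_closedNormalNotLE [CompactSpace G] (hG : JustInfinite G) {W : Subgroup G}
    (hW : IsOpen (W : Set G)) : (closedNormalNotLE W).IsWF := by
  rw [Set.isWF_iff_no_descending_seq]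
  intro f hf hmem
  have hne : (⋂ n, (f n : Set G) \ W).Nonempty := by
    refine IsCompact.nonempty_iInter_of_sequence_nonempty_isCompact_isClosed _
      (fun n => Set.sdiff_subset_sdiff_left (hf n.lt_succ_self).le)
      (fun n => Set.sdiff_nonempty.2 (hmem n).2.2) ?_ fun n => (hmem n).2.1.sdiff hW
    exact ((hmem 0).2.1.sdiff hW).isCompact
  obtain ⟨x, hx⟩ := hne
  rw [Set.mem_iInter] at hx
  have hxb : x ∈ ⨅ n, f n := Subgroup.mem_iInf.2 fun n => (hx n).1
  rw [hG.iInf_eq_bot_of_strictAnti hf (fun n => (hmem n).1) fun n => (hmem n).2.1,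
    Subgroup.mem_bot] at hxb
  exact (hx 0).2 (hxb ▸ W.one_mem)

/-- A closed normal subgroup minimal among those contained in `R` but not in `W`. -/
theorem JustInfinite.exists_minimal [CompactSpace G] (hG : JustInfinite G) {R W : Subgroup G} (hR : R.Normal)
    (hRc : IsClosed (R : Set G)) (hW : IsOpen (W : Set G)) (hRW : ¬ R ≤ W) :
    ∃ X : Subgroup G, X.Normal ∧ IsClosed (X : Set G) ∧ X ≤ R ∧ ¬ X ≤ W ∧
      ∀ Y : Subgroup G, Y.Normal → IsClosed (Y : Set G) → Y ≤ X → Y = X ∨ Y ≤ W := by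
  have hwf : {X | X ∈ closedNormalNotLE W ∧ X ≤ R}.IsWF :=
    (hG.isWF_closedNormalNotLE hW).mono fun X hX => hX.1
  have hne : {X | X ∈ closedNormalNotLE W ∧ X ≤ R}.Nonempty := ⟨R, ⟨hR, hRc, hRW⟩, le_rfl⟩
  obtain ⟨⟨h1, h2, h3⟩, h4⟩ := hwf.min_mem hne
  refine ⟨hwf.min hne, h1, h2, h4, h3, fun Y hY hYc hle => ?_⟩
  by_contra! hno
  exact hwf.not_lt_min hne (a := Y) ⟨⟨hY, hYc, hno.2⟩, hle.trans h4⟩ (lt_of_le_of_ne hle hno.1)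

variable [IsTopologicalGroup G]

theorem JustInfinite.isOpen (hG : JustInfinite G) {N : Subgroup G} (hN : N.Normal)
    (hcl : IsClosed (N : Set G)) (hne : N ≠ ⊥) : IsOpen (N : Set G) :=
  have := hG.finiteIndex hN hcl hne
  N.isOpen_of_isClosed_of_finiteIndex hcl

variable [CompactSpace G]

theorem finiteIndex_of_isOpen {N : Subgroup G} (hN : IsOpen (N : Set G)) : N.FiniteIndex :=
  have := Subgroup.quotient_finite_of_isOpen N hN
  Subgroup.finiteIndex_of_finite_quotient

theorem JustInfinite.ne_bot_of_isOpen (hG : JustInfinite G) {N : Subgroup G}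
    (hN : IsOpen (N : Set G)) : N ≠ ⊥ :=
  have := finiteIndex_of_isOpen hN
  hG.ne_bot_of_finiteIndex

variable [TotallyDisconnectedSpace G]

theorem JustInfinite.exists_lt (hG : JustInfinite G) {K : Subgroup G} (hK : K.Normal)
    (hKc : IsClosed (K : Set G)) (hne : K ≠ ⊥) :
    ∃ L : Subgroup G, L.Normal ∧ IsOpen (L : Set G) ∧ L < K := by
  obtain ⟨⟨x, hx⟩, hx1⟩ := Subgroup.ne_bot_iff_exists_ne_one.1 hne
  obtain ⟨U, hU⟩ := ProfiniteGrp.exist_openNormalSubgroup_sub_open_nhds_of_one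
    (U := {x}ᶜ) isOpen_compl_singleton (fun h => hx1 (Subtype.ext h.symm))
  have hUn : U.toSubgroup.Normal := U.isNormal'
  refine ⟨U.toSubgroup ⊓ K, inferInstance, U.isOpen'.inter (hG.isOpen hK hKc hne),
    lt_of_le_of_ne inf_le_right fun h => ?_⟩
  have : x ∈ U.toSubgroup ⊓ K := h.ge hx
  exact hU this.1 rfl

theorem JustInfinite.ne_bot_of_isChiefFactor (hG : JustInfinite G) {K L : Subgroup G}
    (h : IsChiefFactor K L) : L ≠ ⊥ := by
  rintro rfl
  obtain ⟨hK, hKc, -, -, hlt, hmin⟩ := h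
  obtain ⟨W, hWn, hWo, hWK⟩ := hG.exists_lt hK hKc hlt.ne'
  exact hmin W hWn (W.isClosed_of_isOpen hWo)
    (bot_lt_iff_ne_bot.2 (hG.ne_bot_of_isOpen hWo)) hWK

theorem JustInfinite.isOpen_of_isChiefFactor (hG : JustInfinite G) {K L : Subgroup G}
    (h : IsChiefFactor K L) : IsOpen (L : Set G) :=
  hG.isOpen h.2.2.1 h.2.2.2.1 (hG.ne_bot_of_isChiefFactor h)

/-- Fix one `L₀`, and let `Y` be minimal among closed normal subgroups of `K` not inside `L₀`. Every
`L` contains the open subgroup `Y ⊓ L₀`: otherwise the two generate `K`, and since `Y ⊓ L ≤ L₀` the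
modular law gives `Y ≤ L₀`. -/
theorem JustInfinite.finite_setOf_isChiefFactor (hG : JustInfinite G) (K : Subgroup G) :
    {L | IsChiefFactor K L}.Finite := by
  rcases Set.eq_empty_or_nonempty {L | IsChiefFactor K L} with h0 | ⟨L₀, hL₀⟩
  · rw [h0]; exact Set.finite_empty
  have hL₀o := hG.isOpen_of_isChiefFactor hL₀
  obtain ⟨hK, hKc, hL₀n, -, hlt, -⟩ := hL₀
  obtain ⟨Y, hYn, hYc, hYK, hYL, hY⟩ := hG.exists_minimal hK hKc hL₀o hlt.not_ge
  have hYne : Y ≠ ⊥ := by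
    rintro rfl
    exact hYL bot_le
  have hTo : IsOpen ((Y ⊓ L₀ : Subgroup G) : Set G) := (hG.isOpen hYn hYc hYne).inter hL₀o
  have := finiteIndex_of_isOpen hTo
  refine (finite_setOf_le_of_finiteIndex (Y ⊓ L₀)).subset fun L hL => ?_
  obtain ⟨-, -, hLn, hLc, hLK, hmax⟩ := hL
  by_contra hTL
  rw [Set.mem_ofPred_eq] at hTL
  have hsupo : IsOpen ((Y ⊓ L₀ ⊔ L : Subgroup G) : Set G) :=
    Subgroup.isOpen_mono le_sup_left hTo
  have hsup : Y ⊓ L₀ ⊔ L = K := by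
    by_contra hne
    exact hmax _ inferInstance (Subgroup.isClosed_of_isOpen _ hsupo)
      (lt_of_le_of_ne le_sup_right fun h => hTL (h ▸ le_sup_left))
      (lt_of_le_of_ne (sup_le (inf_le_left.trans hYK) hLK.le) hne)
  have hYL' : Y ⊓ L ≤ L₀ := by
    refine (hY (Y ⊓ L) inferInstance (hYc.inter hLc) inf_le_left).resolve_left fun h => hTL ?_
    exact inf_le_left.trans (inf_eq_left.1 h)
  refine hYL fun y hy => ?_
  have hyK : y ∈ Y ⊓ L₀ ⊔ L := hsup ▸ hYK hy
  rw [Subgroup.mem_sup_of_normal_right] at hyK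
  obtain ⟨t, ht, l, hl, rfl⟩ := hyK
  refine L₀.mul_mem ht.2 (hYL' ⟨?_, hl⟩)
  have := Y.mul_mem (Y.inv_mem ht.1) hy
  rwa [inv_mul_cancel_left] at this

/-- In a just infinite profinite group, an open subgroup contains all but finitely many closed
normal subgroups. -/
theorem JustInfinite.finite_closedNormalNotLE (hG : JustInfinite G) {W : Subgroup G}
    (hW : IsOpen (W : Set G)) : (closedNormalNotLE W).Finite := by
  by_cases htop : (⊤ : Subgroup G) ≤ W
  · refine Set.finite_empty.subset fun K hK => hK.2.2 (le_top.trans htop)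
  suffices h : ∀ K ∈ closedNormalNotLE W, {K' | K' ∈ closedNormalNotLE W ∧ K' ≤ K}.Finite from
    (h ⊤ ⟨inferInstance, isClosed_univ, htop⟩).subset fun K hK => ⟨hK, le_top⟩
  by_contra! hbad
  have hwf : {K | K ∈ closedNormalNotLE W ∧
      ¬ {K' | K' ∈ closedNormalNotLE W ∧ K' ≤ K}.Finite}.IsWF :=
    (hG.isWF_closedNormalNotLE hW).mono fun X hX => hX.1
  have hmem := hwf.min_mem hbad
  have hmin : ∀ L, L ∈ closedNormalNotLE W → L < hwf.min hbad →
      {K' | K' ∈ closedNormalNotLE W ∧ K' ≤ L}.Finite := fun L hL hlt => by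
    by_contra hno
    exact hwf.not_lt_min hbad (a := L) ⟨hL, hno⟩ hlt
  generalize hwf.min hbad = K at hmem hmin
  -- In a minimal counterexample `K`, each proper member lies in some `L` with `K / L` a chief
  -- factor. There are finitely many such `L`, each with finitely many members below it.
  refine hmem.2 (((Set.finite_singleton K).union
    (((hG.finite_setOf_isChiefFactor K).inter_of_left (closedNormalNotLE W)).biUnion
      fun L hL => hmin L hL.2 hL.1.2.2.2.2.1)).subset ?_)
  rintro K' ⟨hK', hle⟩
  by_cases heq : K' = K
  · exact Or.inl heq
  right
  have hne : K' ≠ ⊥ := by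
    rintro rfl
    exact hK'.2.2 bot_le
  have hn := hK'.1
  have := hG.finiteIndex hK'.1 hK'.2.1 hne
  have hfin : {L : Subgroup G | K' ≤ L ∧ L.Normal ∧ L < K}.Finite :=
    (finite_setOf_le_of_finiteIndex K').subset fun L hL => hL.1
  obtain ⟨L, hKL, hL⟩ := hfin.exists_le_maximal (a := K') ⟨le_rfl, hn, lt_of_le_of_ne hle heq⟩
  have hLc : IsClosed (L : Set G) := L.isClosed_of_isOpen
    (Subgroup.isOpen_mono hKL (hG.isOpen hn hK'.2.1 hne))
  rw [Set.mem_iUnion₂]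
  refine ⟨L, ⟨⟨hmem.1.1, hmem.1.2.1, hL.prop.2.1, hLc, hL.prop.2.2, fun M hM _ hLM hMK => ?_⟩,
    hL.prop.2.1, hLc, fun h => hK'.2.2 (hKL.trans h)⟩, hK', hKL⟩
  exact hLM.not_ge (hL.le_of_ge ⟨hKL.trans hLM.le, hM, hMK⟩ hLM.le)

end JustInfinite

/-! ### Centralisers of factors -/

section RelCentralizer

variable {G : Type*} [Group G]

/-- The centraliser of `R / S` in `G`. -/
def relCentralizer (R S : Subgroup G) [S.Normal] : Subgroup G :=
  (Subgroup.centralizer (quotientSubgroup R S : Set (G ⧸ S))).comap (QuotientGroup.mk' S)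

theorem mem_relCentralizer {R S : Subgroup G} [S.Normal] {g : G} :
    g ∈ relCentralizer R S ↔ ∀ r ∈ R, ⁅g, r⁆ ∈ S := by
  have key : ∀ r, ⁅g, r⁆ ∈ S ↔ QuotientGroup.mk' S r * QuotientGroup.mk' S g =
      QuotientGroup.mk' S g * QuotientGroup.mk' S r := by
    intro r
    have h : ⁅g, r⁆ ∈ S ↔ QuotientGroup.mk' S ⁅g, r⁆ = 1 := (QuotientGroup.eq_one_iff _).symm
    rw [h, map_commutatorElement, commutatorElement_eq_one_iff_mul_comm]
    exact eq_comm
  rw [relCentralizer, Subgroup.mem_comap, Subgroup.mem_centralizer_iff]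
  constructor
  · exact fun h r hr => (key r).2 (h _ (Subgroup.mem_map_of_mem _ hr))
  · rintro h _ ⟨r, hr, rfl⟩
    exact (key r).1 (h r hr)

theorem le_relCentralizer_iff {K R S : Subgroup G} [S.Normal] :
    K ≤ relCentralizer R S ↔ ⁅K, R⁆ ≤ S := by
  rw [Subgroup.commutator_le]
  exact ⟨fun h g hg => mem_relCentralizer.1 (h hg), fun h g hg => mem_relCentralizer.2 (h g hg)⟩

theorem le_relCentralizer (R S : Subgroup G) [S.Normal] : S ≤ relCentralizer R S := by
  rw [le_relCentralizer_iff]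
  exact Subgroup.commutator_le_left S R

instance (R S : Subgroup G) [R.Normal] [S.Normal] : (relCentralizer R S).Normal :=
  Subgroup.Normal.comap inferInstance _

variable [TopologicalSpace G]

theorem IsChiefFactor.inf_relCentralizer {R S : Subgroup G} [hS : S.Normal] [hR : R.Normal]
    [IsTopologicalGroup G] (h : IsChiefFactor R S) (hS : IsOpen (S : Set G))
    (hcomm : ¬ ⁅R, R⁆ ≤ S) : R ⊓ relCentralizer R S = S := by
  obtain ⟨-, -, -, -, hlt, hmin⟩ := h
  have hle : S ≤ R ⊓ relCentralizer R S := le_inf hlt.le (le_relCentralizer R S)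
  by_contra hne
  have ho : IsOpen ((R ⊓ relCentralizer R S : Subgroup G) : Set G) := Subgroup.isOpen_mono hle hS
  refine hmin _ inferInstance (Subgroup.isClosed_of_isOpen _ ho)
    (lt_of_le_of_ne hle (Ne.symm hne)) (lt_of_le_of_ne inf_le_left fun h => hcomm ?_)
  exact le_relCentralizer_iff.1 (inf_eq_left.1 h)

end RelCentralizer

/-! ### Chief factors with small centraliser -/

section NarrowFactors

variable {G : Type*} [Group G] [TopologicalSpace G] [IsTopologicalGroup G] [CompactSpace G]
  [TotallyDisconnectedSpace G]

/-- The denominator is recovered as `S = R ⊓ K`. If `X` is minimal among closed normal subgroups of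
one numerator not inside `K`, every numerator `R` contains `X`: otherwise `X ⊓ R ≤ K`, so `⁅X, R⁆ ≤
R ⊓ K = S` and `X ≤ K`. As `X` has finite index, few `R` remain. -/
theorem JustInfinite.finite_setOf_relCentralizer_eq (hG : JustInfinite G) (K : Subgroup G) :
    {RS : Subgroup G × Subgroup G | IsChiefFactor RS.1 RS.2 ∧ ∃ _ : RS.2.Normal,
      ¬ ⁅RS.1, RS.1⁆ ≤ RS.2 ∧ relCentralizer RS.1 RS.2 = K}.Finite := by
  rcases Set.eq_empty_or_nonempty {RS : Subgroup G × Subgroup G | IsChiefFactor RS.1 RS.2 ∧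
    ∃ _ : RS.2.Normal, ¬ ⁅RS.1, RS.1⁆ ≤ RS.2 ∧ relCentralizer RS.1 RS.2 = K} with
    h0 | ⟨⟨R₀, S₀⟩, hch, hS₀, hcomm, rfl⟩
  · rw [h0]; exact Set.finite_empty
  dsimp only at hch hS₀ hcomm ⊢
  have hR₀ := hch.1
  have hS₀o := hG.isOpen_of_isChiefFactor hch
  have hRC : ¬ R₀ ≤ relCentralizer R₀ S₀ := fun h => hcomm (le_relCentralizer_iff.1 h)
  have hCo : IsOpen (relCentralizer R₀ S₀ : Set G) :=
    Subgroup.isOpen_mono (le_relCentralizer R₀ S₀) hS₀o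
  generalize relCentralizer R₀ S₀ = K at hRC hCo
  obtain ⟨X, hXn, hXc, -, hXK, hX⟩ := hG.exists_minimal hR₀ hch.2.1 hCo hRC
  have hXne : X ≠ ⊥ := by
    rintro rfl
    exact hXK bot_le
  have := hG.finiteIndex hXn hXc hXne
  refine ((finite_setOf_le_of_finiteIndex X).image fun R => (R, R ⊓ K)).subset ?_
  rintro ⟨R, S⟩ ⟨hRS, hS, hRcomm, rfl⟩
  dsimp only at hRS hS hRcomm hXK hX ⊢
  have hR := hRS.1
  refine ⟨R, ?_, Prod.ext rfl
    (hRS.inf_relCentralizer (hG.isOpen_of_isChiefFactor hRS) hRcomm)⟩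
  rcases hX (X ⊓ R) inferInstance (hXc.inter hRS.2.1) inf_le_left with h | h
  · exact inf_eq_left.1 h
  · refine absurd (le_relCentralizer_iff.2 ?_) hXK
    refine (Subgroup.commutator_le_inf X R).trans ?_
    rw [← hRS.inf_relCentralizer (hG.isOpen_of_isChiefFactor hRS) hRcomm]
    exact le_inf inf_le_right h

theorem JustInfinite.exists_relCentralizer_le (hG : JustInfinite G)
    {𝓡 : Set (Subgroup G × Subgroup G)} (hinf : 𝓡.Infinite)
    (h𝓡 : ∀ RS ∈ 𝓡, IsChiefFactor RS.1 RS.2 ∧ ¬ ⁅RS.1, RS.1⁆ ≤ RS.2) {W : Subgroup G}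
    (hW : IsOpen (W : Set G)) :
    ∃ RS ∈ 𝓡, ∃ _ : RS.2.Normal, relCentralizer RS.1 RS.2 ≤ W := by
  by_contra! hno
  refine hinf (((hG.finite_closedNormalNotLE hW).biUnion fun K _ =>
    hG.finite_setOf_relCentralizer_eq K).subset fun RS hRS => ?_)
  obtain ⟨hch, hcomm⟩ := h𝓡 RS hRS
  have hR := hch.1
  have hS := hch.2.2.1
  rw [Set.mem_iUnion₂]
  refine ⟨relCentralizer RS.1 RS.2, ⟨inferInstance, ?_, hno RS hRS hS⟩, hch, hS, hcomm, rfl⟩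
  exact Subgroup.isClosed_of_isOpen _
    (Subgroup.isOpen_mono (le_relCentralizer _ _) (hG.isOpen_of_isChiefFactor hch))

end NarrowFactors

/-! ### Narrow factors and a descending sequence of them -/

theorem commutator_sup_le {G : Type*} [Group G] {K X S : Subgroup G} [S.Normal]
    (h : ⁅K, X⁆ ≤ S) : ⁅K, X ⊔ S⁆ ≤ S := by
  have hS : S.map (QuotientGroup.mk' S) = ⊥ := by
    rw [Subgroup.map_eq_bot_iff, QuotientGroup.ker_mk']
  have key : ∀ Y : Subgroup G, Y ≤ S ↔ Y.map (QuotientGroup.mk' S) = ⊥ := fun Y => by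
    rw [Subgroup.map_eq_bot_iff, QuotientGroup.ker_mk']
  rw [key, Subgroup.map_commutator] at h ⊢
  rwa [Subgroup.map_sup, hS, sup_bot_eq]

/-- A nonabelian factor `X / T` of `G` with `T` open such that `T` contains every closed normal
subgroup of `G` properly contained in `X`, satisfying the subprimitivity condition. -/
structure NarrowFactor (G : Type u) [Group G] [TopologicalSpace G] where
  /-- the numerator -/
  X : Subgroup G
  /-- the denominator -/
  T : Subgroup G
  [normal_X : X.Normal]
  [normal_T : T.Normal]
  isOpen_T : IsOpen (T : Set G)
  lt : T < X
  eq_or_le : ∀ Y : Subgroup G, Y.Normal → IsClosed (Y : Set G) → Y ≤ X → Y = X ∨ Y ≤ T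
  not_commutator_le : ¬ ⁅X, X⁆ ≤ T
  subprimitive : SubprimitiveFactors (quotientSubgroup X T)

namespace NarrowFactor

attribute [instance] NarrowFactor.normal_X NarrowFactor.normal_T

section Existence

variable {G : Type u} [Group G] [TopologicalSpace G] [IsTopologicalGroup G] [CompactSpace G]
  [TotallyDisconnectedSpace G]

/-- Take `X ≤ R` minimal subject to not lying in `S`, and `T = X ⊓ S`. Then `X ⊔ S = R`, so `X / T`
is isomorphic to `R / S` and inherits its properties. -/
theorem exists_of_isChiefFactor (hG : JustInfinite G) {R S : Subgroup G} [hR : R.Normal]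
    [hS : S.Normal] (h : IsChiefFactor R S) (hcomm : ¬ ⁅R, R⁆ ≤ S)
    (hs : SubprimitiveFactors (quotientSubgroup R S)) :
    ∃ p : NarrowFactor G, relCentralizer p.X p.T ≤ relCentralizer R S := by
  have hSo := hG.isOpen_of_isChiefFactor h
  obtain ⟨-, hRc, -, -, hlt, hmin⟩ := h
  obtain ⟨X, hXn, hXc, hXR, hXS, hX⟩ := hG.exists_minimal hR hRc hSo hlt.not_ge
  have hXne : X ≠ ⊥ := by
    rintro rfl
    exact hXS bot_le
  have hsup : X ⊔ S = R := by
    by_contra hne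
    exact hmin (X ⊔ S) inferInstance
      (Subgroup.isClosed_of_isOpen _ (Subgroup.isOpen_mono le_sup_right hSo))
      (lt_of_le_of_ne le_sup_right fun h => hXS (h ▸ le_sup_left))
      (lt_of_le_of_ne (sup_le hXR hlt.le) hne)
  have hle : X ⊓ S ≤ S := inf_le_right
  let φ : G ⧸ (X ⊓ S) →* G ⧸ S := QuotientGroup.map (X ⊓ S) S (MonoidHom.id G) hle
  have hφ : Function.Surjective φ := by
    intro y
    obtain ⟨g, rfl⟩ := QuotientGroup.mk'_surjective S y
    exact ⟨QuotientGroup.mk' _ g, rfl⟩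
  refine ⟨⟨X, X ⊓ S, (hG.isOpen hXn hXc hXne).inter hSo,
    lt_of_le_of_ne inf_le_left fun h => hXS (inf_eq_left.1 h),
    fun Y hY hYc hYX => (hX Y hY hYc hYX).imp_right fun h => le_inf hYX h, fun h => hcomm ?_,
    SubprimitiveFactors.of_map (φ := φ) hφ ?_ ?_ hs⟩, ?_⟩
  · have h1 := commutator_sup_le (h.trans hle)
    rw [hsup, Subgroup.commutator_comm] at h1
    have h2 := commutator_sup_le h1
    rwa [hsup] at h2
  · rw [Subgroup.disjoint_def]
    rintro _ ⟨x, hx, rfl⟩ hxk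
    have hxS : x ∈ S := (QuotientGroup.eq_one_iff x).1 hxk
    exact (QuotientGroup.eq_one_iff x).2 ⟨hx, hxS⟩
  · have hcomp : φ.comp (QuotientGroup.mk' (X ⊓ S)) = QuotientGroup.mk' S := rfl
    rw [Subgroup.map_map, hcomp, quotientSubgroup, ← hsup, Subgroup.map_sup]
    have : S.map (QuotientGroup.mk' S) = ⊥ := by
      rw [Subgroup.map_eq_bot_iff, QuotientGroup.ker_mk']
    rw [this, sup_bot_eq]
  · rw [le_relCentralizer_iff]
    have h := le_relCentralizer_iff.1 (le_refl (relCentralizer X (X ⊓ S)))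
    have := commutator_sup_le (h.trans hle)
    rwa [hsup] at this

theorem exists_le (hG : HasManySubprimitiveFactors G) {W : Subgroup G} (hWn : W.Normal)
    (hWo : IsOpen (W : Set G)) :
    ∃ p : NarrowFactor G, p.X ≤ W ∧ relCentralizer p.X p.T < W := by
  obtain ⟨hG, hinf⟩ := hG
  -- The smaller open `W'` makes the inclusion of the centraliser in `W` strict. Strictness then
  -- gives `X ≤ W`: otherwise `X ⊓ W ≤ T`, and `W` would centralise `X / T`.
  obtain ⟨W', hW'n, hW'o, hlt⟩ := hG.exists_lt hWn (W.isClosed_of_isOpen hWo)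
    (hG.ne_bot_of_isOpen hWo)
  have hcomm : ∀ R S : Subgroup G, ∀ _ : S.Normal, (∃ x ∈ quotientSubgroup R S,
      ∃ y ∈ quotientSubgroup R S, x * y ≠ y * x) → ¬ ⁅R, R⁆ ≤ S := by
    rintro R S hS ⟨_, ⟨x, hx, rfl⟩, y, hy, hxy⟩ h
    exact hxy (Subgroup.mem_centralizer_iff.1 (le_relCentralizer_iff.2 h hx) y hy).symm
  obtain ⟨⟨R, S⟩, hRS, hS', hle⟩ := hG.exists_relCentralizer_le hinf
    (fun RS ⟨h, _, hS, hne, _⟩ => ⟨h, hcomm _ _ hS hne⟩) hW'o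
  obtain ⟨hch, hR, hS, hne, hs⟩ := hRS
  obtain ⟨p, hp⟩ := exists_of_isChiefFactor hG hch (hcomm _ _ hS hne) hs
  have hC : relCentralizer p.X p.T < W := (hp.trans hle).trans_lt hlt
  refine ⟨p, ?_, hC⟩
  have hXc : IsClosed (p.X : Set G) :=
    Subgroup.isClosed_of_isOpen _ (Subgroup.isOpen_mono p.lt.le p.isOpen_T)
  rcases p.eq_or_le (p.X ⊓ W) inferInstance (hXc.inter (W.isClosed_of_isOpen hWo)) inf_le_left
    with h | h
  · exact inf_eq_left.1 h
  · refine absurd (le_relCentralizer_iff.2 ?_) hC.not_ge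
    rw [Subgroup.commutator_comm]
    exact (Subgroup.commutator_le_inf p.X W).trans h

theorem exists_sequence (hG : HasManySubprimitiveFactors G) :
    ∃ p : ℕ → NarrowFactor G, ∀ n, (p (n + 1)).X ≤ (p n).T ∧
      relCentralizer (p (n + 1)).X (p (n + 1)).T < (p n).T := by
  have hstep : ∀ p : NarrowFactor G, ∃ q : NarrowFactor G, q.X ≤ p.T ∧
      relCentralizer q.X q.T < p.T := fun p => exists_le hG p.normal_T p.isOpen_T
  choose f hf using hstep
  obtain ⟨p₀, -⟩ := exists_le hG (W := ⊤) inferInstance isOpen_univ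
  exact ⟨fun n => f^[n] p₀, fun n => by
    simp only [Function.iterate_succ_apply']
    exact hf _⟩

end Existence

section Quotients

variable {G H : Type u} [Group G] [TopologicalSpace G] [IsTopologicalGroup G] [Group H]
  (p : NarrowFactor G) {q : G →* H}

theorem eq_or_le_of_le_map (hker : IsOpen (q.ker : Set G))
    {Y : Subgroup H} (hY : Y.Normal) (hYX : Y ≤ p.X.map q) : Y = p.X.map q ∨ Y ≤ p.T.map q := by
  have hcl : IsClosed ((Y.comap q ⊓ p.X : Subgroup G) : Set G) := by
    refine IsClosed.inter ?_ ?_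
    · exact Subgroup.isClosed_of_isOpen _
        (Subgroup.isOpen_mono (Subgroup.comap_mono (bot_le : ⊥ ≤ Y)) hker)
    · exact Subgroup.isClosed_of_isOpen _ (Subgroup.isOpen_mono p.lt.le p.isOpen_T)
  have hn := hY.comap q
  rcases p.eq_or_le _ inferInstance hcl inf_le_right with h | h
  · exact Or.inl (le_antisymm hYX (Subgroup.map_le_iff_le_comap.2 (inf_eq_right.1 h)))
  · right
    intro y hy
    obtain ⟨x, hx, rfl⟩ := hYX hy
    exact Subgroup.mem_map_of_mem q (h ⟨hy, hx⟩)

theorem map_melnikov_map_eq [Finite H] (hq : Function.Surjective q) (hker : q.ker ≤ p.T)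
    (hkero : IsOpen (q.ker : Set G)) [TopologicalSpace (p.X.map q)]
    [DiscreteTopology (p.X.map q)] :
    (melnikov (p.X.map q)).map (p.X.map q).subtype = p.T.map q := by
  have hX : (p.X.map q).Normal := p.normal_X.map q hq
  have hT : (p.T.map q).Normal := p.normal_T.map q hq
  refine map_melnikov_eq (lt_of_le_not_ge (Subgroup.map_mono p.lt.le) fun h => ?_) (fun h => ?_)
    fun Y hY hYX => p.eq_or_le_of_le_map hkero hY hYX
  · rw [Subgroup.map_le_map_iff, sup_eq_left.2 hker] at h
    exact p.lt.not_ge h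
  · rw [← Subgroup.map_commutator, Subgroup.map_le_map_iff, sup_eq_left.2 hker] at h
    exact p.not_commutator_le h

theorem isProductOfNonabelianSimple_map [Finite H] (hq : Function.Surjective q)
    (hker : q.ker = p.T) : IsProductOfNonabelianSimple (p.X.map q) := by
  have hX : (p.X.map q).Normal := p.normal_X.map q hq
  refine isProductOfNonabelianSimple_of_minimal (fun Y hY hYX => ?_) fun h => ?_
  · have hbot : p.T.map q = ⊥ := by rw [Subgroup.map_eq_bot_iff, hker]
    refine (p.eq_or_le_of_le_map (hker ▸ p.isOpen_T) hY hYX).imp_right fun h => ?_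
    rwa [hbot, le_bot_iff] at h
  · rw [← Subgroup.map_commutator, Subgroup.map_eq_bot_iff, hker] at h
    exact p.not_commutator_le h

end Quotients

end NarrowFactor

/-! ### A profinite group as the limit of a sequence of quotients -/

section QuotientSystem

variable {G : Type u} [Group G]

/-- The inverse system of the finite quotients of `G` by a descending sequence of normal
subgroups. -/
def quotientSystem (T : ℕ → Subgroup G) [∀ n, (T n).Normal] [∀ n, Finite (G ⧸ T n)]
    (hT : ∀ n, T (n + 1) ≤ T n) : InverseSystem.{u} where
  G n := G ⧸ T n
  ρ n := QuotientGroup.map (T (n + 1)) (T n) (MonoidHom.id G) (hT n)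
  surj n y := by
    obtain ⟨g, rfl⟩ := QuotientGroup.mk'_surjective (T n) y
    exact ⟨QuotientGroup.mk' _ g, rfl⟩

variable (T : ℕ → Subgroup G) [∀ n, (T n).Normal] [∀ n, Finite (G ⧸ T n)]
  (hT : ∀ n, T (n + 1) ≤ T n)

/-- The quotient maps from `G` to the groups of the system. -/
def quotientSystem.mk (n : ℕ) : G →* (quotientSystem T hT).G n := QuotientGroup.mk' (T n)

theorem quotientSystem.mk_surjective (n : ℕ) : Function.Surjective (quotientSystem.mk T hT n) :=
  QuotientGroup.mk'_surjective (T n)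

theorem quotientSystem.ker_mk (n : ℕ) : (quotientSystem.mk T hT n).ker = T n :=
  QuotientGroup.ker_mk' (T n)

theorem quotientSystem.ρ_comp_mk (n : ℕ) :
    ((quotientSystem T hT).ρ n).comp (quotientSystem.mk T hT (n + 1)) = quotientSystem.mk T hT n :=
  rfl

theorem quotientSystem.ker_ρ (n : ℕ) :
    ((quotientSystem T hT).ρ n).ker = (T n).map (quotientSystem.mk T hT (n + 1)) := by
  rw [← Subgroup.map_comap_eq_self_of_surjective (quotientSystem.mk_surjective T hT (n + 1))
    ((quotientSystem T hT).ρ n).ker, MonoidHom.comap_ker, quotientSystem.ρ_comp_mk,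
    quotientSystem.ker_mk]

/-- The canonical map to the inverse limit. -/
def quotientSystem.toLimit : G →* (quotientSystem T hT).limit where
  toFun g := ⟨fun n => quotientSystem.mk T hT n g, fun _ => rfl⟩
  map_one' := rfl
  map_mul' _ _ := rfl

variable [TopologicalSpace G] [IsTopologicalGroup G]

theorem quotientSystem.continuous_mk (hTo : ∀ n, IsOpen (T n : Set G)) (n : ℕ) :
    Continuous (quotientSystem.mk T hT n) := by
  refine continuous_discrete_rng.2 fun y => ?_
  obtain ⟨g, rfl⟩ := quotientSystem.mk_surjective T hT n y
  have : quotientSystem.mk T hT n ⁻¹' {quotientSystem.mk T hT n g} =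
      (fun x => g⁻¹ * x) ⁻¹' (T n : Set G) := by
    ext x
    rw [Set.mem_preimage, Set.mem_singleton_iff, Set.mem_preimage, SetLike.mem_coe,
      ← quotientSystem.ker_mk T hT n, MonoidHom.mem_ker, map_mul, map_inv, inv_mul_eq_one]
    exact eq_comm
  rw [this]
  exact (hTo n).preimage (by fun_prop)

/-- A profinite group is the inverse limit of its quotients by a descending sequence of open normal
subgroups with trivial intersection. -/
theorem quotientSystem.nonempty_continuousMulEquiv [CompactSpace G]
    (hTo : ∀ n, IsOpen (T n : Set G)) (hbot : ⨅ n, T n = ⊥) :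
    Nonempty (G ≃ₜ* (quotientSystem T hT).limit) := by
  have hcont : Continuous (quotientSystem.toLimit T hT) :=
    (continuous_pi (quotientSystem.continuous_mk T hT hTo)).subtype_mk _
  have hinj : Function.Injective (quotientSystem.toLimit T hT) := by
    rw [← MonoidHom.ker_eq_bot_iff, ← le_bot_iff, ← hbot]
    refine fun g hg => Subgroup.mem_iInf.2 fun n => ?_
    rw [← quotientSystem.ker_mk T hT n]
    exact congrFun (congrArg Subtype.val hg) n
  have hsurj : Function.Surjective (quotientSystem.toLimit T hT) := by
    rintro ⟨x, hx⟩
    -- The fibres are nested nonempty closed sets in a compact space, so a compatible sequence comes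
    -- from an element of `G`.
    have hne : (⋂ n, quotientSystem.mk T hT n ⁻¹' {x n}).Nonempty := by
      have hcl : ∀ n, IsClosed (quotientSystem.mk T hT n ⁻¹' {x n}) := fun n =>
        (isClosed_discrete _).preimage (quotientSystem.continuous_mk T hT hTo n)
      refine IsCompact.nonempty_iInter_of_sequence_nonempty_isCompact_isClosed _ (fun n g hg => ?_)
        (fun n => ?_) (hcl 0).isCompact hcl
      · rw [Set.mem_preimage, Set.mem_singleton_iff] at hg ⊢
        rw [← quotientSystem.ρ_comp_mk, MonoidHom.comp_apply, hg]
        exact hx n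
      · obtain ⟨g, hg⟩ := quotientSystem.mk_surjective T hT n (x n)
        exact ⟨g, hg⟩
    obtain ⟨g, hg⟩ := hne
    exact ⟨g, Subtype.ext (funext fun n => Set.mem_iInter.1 hg n)⟩
  let e : G ≃* (quotientSystem T hT).limit := MulEquiv.ofBijective _ ⟨hinj, hsurj⟩
  let e' : G ≃ₜ (quotientSystem T hT).limit :=
    Continuous.homeoOfEquivCompactToT2 (f := e.toEquiv) hcont
  exact ⟨{ e with
    continuous_toFun := hcont
    continuous_invFun := e'.symm.continuous }⟩

end QuotientSystem

/-! ### The inverse system attached to a sequence of narrow factors -/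

section NarrowSystem

variable {G : Type u} [Group G] [TopologicalSpace G] [IsTopologicalGroup G] [CompactSpace G]

theorem SubprimitiveFactors.congr {G : Type u} [Group G] {P Q : Subgroup G} [P.Normal] [Q.Normal]
    (h : P = Q) (hP : SubprimitiveFactors P) : SubprimitiveFactors Q := by
  subst h
  exact hP

instance (p : NarrowFactor G) : Finite (G ⧸ p.T) := Subgroup.quotient_finite_of_isOpen _ p.isOpen_T

/-- The normal subgroups `X n / T (n + 1)` of the system of quotients by the `T n`. -/
def narrowSubgroup (p : ℕ → NarrowFactor G) (hT : ∀ n, (p (n + 1)).T ≤ (p n).T) :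
    ∀ n, Subgroup ((quotientSystem (fun n => (p n).T) hT).G n)
  -- An arbitrary value: the conditions from index `1` on never involve it.
  | 0 => ⊤
  | n + 1 => (p n).X.map (quotientSystem.mk (fun n => (p n).T) hT (n + 1))

variable (p : ℕ → NarrowFactor G) (hT : ∀ n, (p (n + 1)).T ≤ (p n).T)

instance narrowSubgroup_normal (n : ℕ) : (narrowSubgroup p hT n).Normal := by
  cases n with
  | zero =>
    change (⊤ : Subgroup ((quotientSystem (fun n => (p n).T) hT).G 0)).Normal
    infer_instance
  | succ n =>
    exact (p n).normal_X.map _ (quotientSystem.mk_surjective (fun n => (p n).T) hT (n + 1))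

theorem P_narrowSubgroup (n : ℕ) :
    (quotientSystem (fun n => (p n).T) hT).P (narrowSubgroup p hT) n =
      (p n).X.map (quotientSystem.mk (fun n => (p n).T) hT n) := by
  rw [InverseSystem.P, narrowSubgroup, Subgroup.map_map, quotientSystem.ρ_comp_mk]

/-- Here `P n = X n / T n` and `ker (ρ n) = T n / T (n + 1)`. Narrowness gives the Mel'nikov
condition, `X (n + 1) ≤ T n` gives `P ≤ ker`, and the centraliser bound gives the strict inclusion
because `T n < X n`. -/
theorem conditionsAt_narrowSubgroup (hX : ∀ n, (p (n + 1)).X ≤ (p n).T)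
    (hC : ∀ n, relCentralizer (p (n + 1)).X (p (n + 1)).T < (p n).T) (n : ℕ) :
    (quotientSystem (fun n => (p n).T) hT).ConditionsAt (narrowSubgroup p hT) (n + 1) where
  melnikov_eq := by
    rw [quotientSystem.ker_ρ]
    refine (p (n + 1)).map_melnikov_map_eq (quotientSystem.mk_surjective _ hT _) ?_ ?_
    · rw [quotientSystem.ker_mk]
      exact hT (n + 1)
    · rw [quotientSystem.ker_mk]
      exact (p (n + 2)).isOpen_T
  P_le := by
    rw [quotientSystem.ker_ρ, P_narrowSubgroup]
    exact Subgroup.map_mono (hX (n + 1))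
  centralizer_lt := by
    rw [P_narrowSubgroup]
    have hcent : Subgroup.centralizer
        ((p (n + 1)).X.map (quotientSystem.mk (fun n => (p n).T) hT (n + 1)) : Set _) =
        (relCentralizer (p (n + 1)).X (p (n + 1)).T).map
          (quotientSystem.mk (fun n => (p n).T) hT (n + 1)) :=
      (Subgroup.map_comap_eq_self_of_surjective
        (quotientSystem.mk_surjective (fun n => (p n).T) hT (n + 1)) _).symm
    rw [hcent]
    refine lt_of_le_not_ge (Subgroup.map_mono ((hC n).le.trans (p n).lt.le)) fun h => ?_
    rw [narrowSubgroup, Subgroup.map_le_map_iff, quotientSystem.ker_mk,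
      sup_eq_left.2 (le_relCentralizer _ _)] at h
    exact ((hC n).trans (p n).lt).not_ge h
  product := by
    rw [P_narrowSubgroup]
    have : Finite ((quotientSystem (fun n => (p n).T) hT).G (n + 1)) := inferInstance
    exact (p (n + 1)).isProductOfNonabelianSimple_map (quotientSystem.mk_surjective _ hT _)
      (quotientSystem.ker_mk _ hT _)
  subprimitive := by
    have : ((p (n + 1)).X.map (quotientSystem.mk (fun n => (p n).T) hT (n + 1))).Normal :=
      (p (n + 1)).normal_X.map _ (quotientSystem.mk_surjective _ hT _)
    exact SubprimitiveFactors.congr (P_narrowSubgroup p hT (n + 1)).symm (p (n + 1)).subprimitive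

end NarrowSystem

end HJI

theorem theorem6p2 :
    (∀ (Λ : HJI.InverseSystem.{u}) (A : ∀ n, Subgroup (Λ.G n)) [∀ n, (A n).Normal],
      (∀ᶠ n in Filter.atTop, Λ.ConditionsAt A n) →
        HJI.HereditarilyJustInfinite Λ.limit ∧ ¬ HJI.VirtuallyProsoluble Λ.limit) ∧
    (∀ (G : Type u) [Group G] [TopologicalSpace G] [IsTopologicalGroup G] [CompactSpace G]
      [T2Space G] [TotallyDisconnectedSpace G],
      HJI.HasManySubprimitiveFactors G →
        ∃ (Λ : HJI.InverseSystem.{u}) (A : ∀ n, Subgroup (Λ.G n)) (_ : ∀ n, (A n).Normal),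
          (∀ᶠ n in Filter.atTop, Λ.ConditionsAt A n) ∧ Nonempty (G ≃ₜ* Λ.limit)) := by
  refine ⟨fun Λ A _ hΛ => ?_, fun G _ _ _ _ _ _ hG => ?_⟩
  · obtain ⟨n₀, hΛ⟩ := Filter.eventually_atTop.1 hΛ
    exact ⟨HJI.InverseSystem.hereditarilyJustInfinite hΛ,
      HJI.InverseSystem.not_virtuallyProsoluble hΛ⟩
  · obtain ⟨p, hp⟩ := HJI.NarrowFactor.exists_sequence hG
    have hlt : ∀ n, (p (n + 1)).T < (p n).T := fun n => (p (n + 1)).lt.trans_le (hp n).1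
    have hT : ∀ n, (p (n + 1)).T ≤ (p n).T := fun n => (hlt n).le
    refine ⟨HJI.quotientSystem (fun n => (p n).T) hT, HJI.narrowSubgroup p hT,
      HJI.narrowSubgroup_normal p hT, ?_, ?_⟩
    · refine Filter.eventually_atTop.2 ⟨1, fun n hn => ?_⟩
      obtain ⟨n, rfl⟩ : ∃ k, n = k + 1 := ⟨n - 1, by omega⟩
      exact HJI.conditionsAt_narrowSubgroup p hT (fun n => (hp n).1) (fun n => (hp n).2) n
    · exact HJI.quotientSystem.nonempty_continuousMulEquiv _ hT (fun n => (p n).isOpen_T)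
        (hG.1.iInf_eq_bot_of_strictAnti (strictAnti_nat_of_succ_lt hlt) (fun n => (p n).normal_T)
          fun n => (p n).T.isClosed_of_isOpen (p n).isOpen_T)
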